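/- Let $r \ge 2$ be an integer and let $\mathcal{F}$ be an arbitrary (possibly infinite) family of finite graphs; forests are allowed. A graph $G$ is \emph{$r$-list-Ramsey with respect to $\mathcal{F}$}, written $G \in \mathrm{Ram}_\ell(\mathcal{F}, r)$, if there is an assignment of lists of $r$ colours to the edges of $G$, not necessarily identical, such that every colouring of the edges from these lists admits a monochromatic copy of some $F \in \mathcal{F}$. A \emph{broom} is a tree obtained from a path of length two by attaching an arbitrary number of leaves to one of its endpoints. A graph is a \emph{$\mathcal{B}$-graph} if each of its components is a subgraph of a broom; it is a \emph{$\mathcal{C}^*$-graph} if each of its components is a subgraph of an odd cycle or a star; it is a \emph{star forest} if each of its components is a star (a single vertex counts as a star). Call the pair $(\mathcal{F}, r)$ \emph{exceptional} if $\mathcal{F}$ contains a star forest, or if $r = 2$ and $\mathcal{F}$ contains both a $\mathcal{B}$-graph and a $\mathcal{C}^*$-graph. (For $r = 2$ the first alternative is a special case of the second.) If $(\mathcal{F}, r)$ is not exceptional, then there is a constant $c_0 > 0$ (depending only on $\mathcal{F}$ and $r$) such that, for all $p = p(n) \in [0,1]$ with $p \le c_0 \cdot n^{-1}$, \[ \lim_{n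 \to \infty} \Pr\bigl(G_{n,p} \in \mathrm{Ram}_\ell(\mathcal{F}, r)\bigr) = 0 . \] If $(\mathcal{F}, r)$ is exceptional, then for every $p = p(n) \in [0,1]$ with $p = \Omega(n^{-1})$ the probability $\Pr\bigl(G_{n,p} \in \mathrm{Ram}_\ell(\mathcal{F}, r)\bigr)$ is bounded away from zero for all sufficiently large $n$. -/

import Mathlib

open Filter Topology

namespace SimpleGraph

/-- The graph `G` is `r`-list-Ramsey with respect to the family `F`: one can assign to every edge
of `G` a list of `r` colours so that every colouring `χ` of the edges from these lists admits a
colour `a` whose colour class contains a (not necessarily induced) copy of a member of `F`.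
Colours are natural numbers; this is no restriction for finite `G`. -/
def ListRamsey {ι : Type*} {W : ι → Type*} (F : ∀ i, SimpleGraph (W i)) (r : ℕ)
    {V : Type*} (G : SimpleGraph V) : Prop :=
  ∃ L : G.edgeSet → Finset ℕ, (∀ e, (L e).card = r) ∧
    ∀ χ : G.EdgeLabeling ℕ, (∀ e, χ e ∈ L e) →
      ∃ i, ∃ a : ℕ, (F i).IsContained (χ.labelGraph a)

/-- The broom with `b` hairs: the path `0, 1, 2` of length two, together with `b` leaves
attached to its endpoint `2`. -/
def broom (b : ℕ) : SimpleGraph (Fin 3 ⊕ Fin b) :=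
  fromEdgeSet ({s(Sum.inl 0, Sum.inl 1), s(Sum.inl 1, Sum.inl 2)} ∪
    Set.range fun h : Fin b => s(Sum.inl 2, Sum.inr h))

/-- The graph is a star (possibly a single vertex). -/
def IsStar {V : Type*} (G : SimpleGraph V) : Prop :=
  ∃ c : V, G = starGraph c

/-- Every connected component is a star. -/
def IsStarForest {V : Type*} (G : SimpleGraph V) : Prop :=
  ∀ C : G.ConnectedComponent, C.toSimpleGraph.IsStar

/-- Every connected component is a subgraph of a broom. -/
def IsBGraph {V : Type*} (G : SimpleGraph V) : Prop :=
  ∀ C : G.ConnectedComponent, ∃ b : ℕ, C.toSimpleGraph.IsContained (broom b)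

/-- Every connected component is a subgraph of an odd cycle, or a star. -/
def IsCStarGraph {V : Type*} (G : SimpleGraph V) : Prop :=
  ∀ C : G.ConnectedComponent,
    (∃ l : ℕ, 1 ≤ l ∧ C.toSimpleGraph.IsContained (cycleGraph (2 * l + 1))) ∨
      C.toSimpleGraph.IsStar

/-- The exceptional families for the list-Ramsey property at edge probability `1 / n`: those that
contain a star forest and, for two colours, those that contain both a `𝓑`-graph and a
`𝓒*`-graph. -/
def ListRamseyExceptional {ι : Type*} {W : ι → Type*} (F : ∀ i, SimpleGraph (W i)) (r : ℕ) :
    Prop :=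
  (∃ i, (F i).IsStarForest) ∨ (r = 2 ∧ (∃ i, (F i).IsBGraph) ∧ ∃ i, (F i).IsCStarGraph)

/-- The probability that the binomial random graph on `n` vertices with edge probability `p`
is `r`-list-Ramsey with respect to `F`. -/
noncomputable def probListRamsey {ι : Type*} {W : ι → Type*} (F : ∀ i, SimpleGraph (W i)) (r : ℕ)
    (n : ℕ) (p : unitInterval) : ℝ :=
  (binomialRandom (Fin n) p).real {G | ListRamsey F r G}

end SimpleGraph

/-!
Call a graph *functional* if its edges are the pairs `v — f v` for a self-map `f` of its vertices,
that is, if it has an orientation with out-degrees at most one. These are the graphs all of whose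
components have at most one cycle, and both directions reduce to them.

*Non-exceptional families.* If `p ≤ 1 / (40 n)`, a union bound over all sets of `s` vertices
spanning `s + 1` edges, together with Hall's theorem, shows that `G(n, p)` is functional up to
probability `1 / n` (`SimpleGraph.binomialRandom_not_isFunctional_le`). A choice of a colour `χ v`
from the list of every edge `v — f v` produces colour classes that are star forests, except where
there is a conflict `χ v = χ (f v)`. Colouring greedily against the direction of `f`, starting from
one point on each cycle, one can

* avoid all conflicts if the lists have size three (`exists_listColoring_of_three_le`);
* have at most one conflict per component, so that the colour classes are `𝓑`-graphs
  (`exists_listColoring_conflicts_separated`, `SimpleGraph.exists_broom_of_conflict`);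
* for lists of size two, have conflicts only on monochromatic odd cycles, so that the colour
  classes are `𝓒*`-graphs (`exists_listColoring_conflicts_odd`,
  `SimpleGraph.exists_oddCycle_of_conflict`).

For a family that is not exceptional one of these colourings avoids all its members
(`SimpleGraph.IsFunctional.not_listRamsey`).

*Exceptional families.* A fixed functional graph with all out-degrees equal to one has as many edges as
vertices, and its subgraphs have at most as many edges as vertices. Hence the second moment method finds it in `G(n, p)` with
probability bounded away from zero as soon as `n p` is
(`SimpleGraph.exists_pos_le_binomialRandom_copy`), and it remains to exhibit a functional graph that
is list-Ramsey. It is a disjoint union of odd cycles with many hairs at each vertex. Such a hairy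
cycle always contains a large monochromatic star, and if its lists are constant of size two, it
contains a monochromatic broom with many hairs or its cycle is monochromatic
(`SimpleGraph.exists_broom_or_cycle`). Using all pairs from a sufficiently large palette as lists
brings the different odd cycles required by a `𝓒*`-graph into one common colour
(`SimpleGraph.exists_listRamsey_of_isBGraph_of_isCStarGraph`).
-/

/-! ### Probability estimates for binomial random graphs -/

open MeasureTheory in
/-- The second moment method for a union of events in a finite probability space. -/
theorem sq_sum_measureReal_le {α Ω : Type*} [Finite Ω] [MeasurableSpace Ω]
    [MeasurableSingletonClass Ω] (μ : Measure Ω) [IsFiniteMeasure μ]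
    (T : Finset α) (A : α → Set Ω) :
    (∑ a ∈ T, μ.real (A a)) ^ 2 ≤
      μ.real (⋃ a ∈ T, A a) * ∑ a ∈ T, ∑ b ∈ T, μ.real (A a ∩ A b) := by
  classical
  cases nonempty_fintype Ω
  have hμ (S : Set Ω) : μ.real S = ∑ ω, μ.real {ω} * (if ω ∈ S then 1 else 0) := by
    have h := sum_measureReal_singleton (μ := μ) (Finset.univ.filter (· ∈ S))
    simp only [Finset.coe_filter, Finset.mem_univ, true_and, Set.ofPred_mem_eq] at h
    rw [← h, Finset.sum_filter]
    simp
  have key := Finset.sum_sq_le_sum_mul_sum_of_sq_le_mul (Finset.univ : Finset Ω)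
    (r := fun ω => μ.real {ω} * ∑ a ∈ T, (if ω ∈ A a then (1 : ℝ) else 0))
    (f := fun ω => μ.real {ω} * (if ω ∈ ⋃ a ∈ T, A a then (1 : ℝ) else 0))
    (g := fun ω => μ.real {ω} * (∑ a ∈ T, (if ω ∈ A a then (1 : ℝ) else 0)) ^ 2)
    (fun ω _ => by positivity) (fun ω _ => by positivity) (fun ω _ => by
      split_ifs with h
      · exact le_of_eq (by ring)
      · have : ∑ a ∈ T, (if ω ∈ A a then (1 : ℝ) else 0) = 0 := by
          refine Finset.sum_eq_zero fun a ha => if_neg fun hω => h ?_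
          exact Set.mem_biUnion ha hω
        simp [this])
  have e1 : ∑ a ∈ T, μ.real (A a) =
      ∑ ω, μ.real {ω} * ∑ a ∈ T, (if ω ∈ A a then (1 : ℝ) else 0) := by
    simp_rw [Finset.mul_sum]
    rw [Finset.sum_comm]
    exact Finset.sum_congr rfl fun a _ => hμ _
  have e2 : ∑ a ∈ T, ∑ b ∈ T, μ.real (A a ∩ A b) =
      ∑ ω, μ.real {ω} * (∑ a ∈ T, (if ω ∈ A a then (1 : ℝ) else 0)) ^ 2 := by
    simp_rw [sq, Finset.sum_mul_sum, Finset.mul_sum]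
    rw [Finset.sum_comm]
    refine (Finset.sum_congr rfl fun a _ => ?_).trans Finset.sum_comm
    rw [Finset.sum_comm]
    refine Finset.sum_congr rfl fun b _ => ?_
    rw [hμ]
    refine Finset.sum_congr rfl fun ω _ => ?_
    by_cases h1 : ω ∈ A a <;> by_cases h2 : ω ∈ A b <;> simp [h1, h2]
  rw [e1, e2, hμ (⋃ a ∈ T, A a)]
  exact key

namespace SimpleGraph

instance discreteMeasurableSpace {V : Type*} [Finite V] :
    DiscreteMeasurableSpace (SimpleGraph V) := by
  have : MeasurableSingletonClass (SimpleGraph V) := ⟨fun G => by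
    have : ({G} : Set (SimpleGraph V)) = edgeSet ⁻¹' {G.edgeSet} := by
      ext H; simp
    rw [this]
    exact measurable_edgeSet (measurableSet_singleton _)⟩
  infer_instance

open MeasureTheory ProbabilityTheory unitInterval in
theorem binomialRandom_real_superset {V : Type*} [Finite V] (p : I)
    (J : Finset (Sym2 V)) (hJ : ∀ e ∈ J, ¬ e.IsDiag) :
    (binomialRandom V p).real {G | ∀ e ∈ J, e ∈ G.edgeSet} = (p : ℝ) ^ J.card := by
  classical
  have h : (binomialRandom V p) {G | ∀ e ∈ J, e ∈ G.edgeSet} =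
      (toNNReal p : ENNReal) ^ J.card := by
    rw [binomialRandom_eq_map, Measure.map_apply measurable_fromEdgeSet .of_discrete,
      setBernoulli_apply']
    have : ((fun p : Sym2 V → Prop => {i | p i}) ⁻¹'
        (fromEdgeSet ⁻¹' {G : SimpleGraph V | ∀ e ∈ J, e ∈ G.edgeSet})) =
        (J : Set (Sym2 V)).pi fun _ => ({True} : Set Prop) := by
      ext q
      simp only [Set.mem_preimage, Set.mem_ofPred_eq, edgeSet_fromEdgeSet, Set.mem_sdiff,
        Set.mem_pi, Set.mem_singleton_iff, eq_iff_iff, iff_true, Finset.mem_coe]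
      exact ⟨fun h e he => (h e he).1, fun h e he => ⟨h e he, hJ e he⟩⟩
    rw [this, Measure.infinitePi_pi _ (fun _ _ => .of_discrete)]
    rw [Finset.prod_congr rfl (g := fun _ => (toNNReal p : ENNReal)), Finset.prod_const]
    intro e he
    have : ¬ e.IsDiag := hJ e he
    simp [this]
  rw [measureReal_def, h]
  simp

open MeasureTheory unitInterval in
/-- Let `f` be a self-map of a finite set `V` of size `N` without fixed points or 2-cycles. The
graph with edges `v — f v` has as many edges as vertices, and no subgraph of it is denser. So the
second moment method bounds below the probability of finding a copy of it in `G(n, p)`. -/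
theorem descFactorial_mul_pow_le_binomialRandom {V : Type*} [Fintype V] (f : V → V)
    (h1 : ∀ v, f v ≠ v) (h2 : ∀ v, f (f v) ≠ v) (n : ℕ) (p : I) :
    (n.descFactorial (Fintype.card V) : ℝ) * (p : ℝ) ^ Fintype.card V ≤
      (binomialRandom (Fin n) p).real
        {G | ∃ φ : V ↪ Fin n, ∀ v, G.Adj (φ v) (φ (f v))} *
        (Fintype.card V + n * p) ^ Fintype.card V := by
  classical
  set N := Fintype.card V with hN
  have hp0 : (0 : ℝ) ≤ p := p.2.1
  have hp1 : (p : ℝ) ≤ 1 := p.2.2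
  let edge : (V ↪ Fin n) → V → Sym2 (Fin n) := fun φ v => s(φ v, φ (f v))
  have edge_inj (φ : V ↪ Fin n) : Function.Injective (edge φ) := by
    intro u v huv
    simp only [edge, Sym2.eq_iff, φ.injective.eq_iff] at huv
    rcases huv with h | ⟨h, h'⟩
    · exact h.1
    · exact absurd (by rw [← h, h']) (h2 v)
  let E : (V ↪ Fin n) → Finset (Sym2 (Fin n)) := fun φ => Finset.univ.image (edge φ)
  have hE (φ : V ↪ Fin n) : (E φ).card = N := by
    rw [Finset.card_image_of_injective _ (edge_inj φ), Finset.card_univ]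
  have hdiag (φ : V ↪ Fin n) : ∀ e ∈ E φ, ¬ e.IsDiag := by
    intro e he
    obtain ⟨v, -, rfl⟩ := Finset.mem_image.1 he
    simp only [edge, Sym2.mk_isDiag_iff, φ.injective.eq_iff]
    exact (h1 v).symm
  let A : (V ↪ Fin n) → Set (SimpleGraph (Fin n)) :=
    fun φ => {G | ∀ e ∈ E φ, e ∈ G.edgeSet}
  have hA (φ : V ↪ Fin n) : (binomialRandom (Fin n) p).real (A φ) = (p : ℝ) ^ N := by
    rw [binomialRandom_real_superset p _ (hdiag φ), hE]
  let w : (V ↪ Fin n) → Fin n → ℝ := fun φ x => if x ∈ Set.range φ then 1 else p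
  have hw (φ : V ↪ Fin n) (x : Fin n) : 0 ≤ w φ x := by
    simp only [w]; split_ifs <;> [exact zero_le_one; exact hp0]
  -- an edge of the second copy leaving from a vertex outside the first copy is a new edge
  have hAA (φ ψ : V ↪ Fin n) : (binomialRandom (Fin n) p).real (A φ ∩ A ψ) ≤
      (p : ℝ) ^ N * ∏ u, w φ (ψ u) := by
    have e1 : A φ ∩ A ψ = {G | ∀ e ∈ E φ ∪ E ψ, e ∈ G.edgeSet} := by
      ext G
      simp only [A, Set.mem_inter_iff, Set.mem_ofPred_eq, Finset.mem_union]
      exact ⟨fun h e he => he.elim (h.1 e) (h.2 e), fun h => ⟨fun e he => h e (.inl he),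
        fun e he => h e (.inr he)⟩⟩
    rw [e1, binomialRandom_real_superset p _ (fun e he =>
      (Finset.mem_union.1 he).elim (hdiag φ e) (hdiag ψ e))]
    have e2 : ∏ u, w φ (ψ u) =
        (p : ℝ) ^ (Finset.univ.filter fun u => ψ u ∉ Set.range φ).card := by
      simp only [w]
      rw [Finset.prod_ite]
      simp
    rw [e2, ← pow_add]
    refine pow_le_pow_of_le_one hp0 hp1 ?_
    rw [Finset.union_comm, ← Finset.card_sdiff_add_card, hE φ, add_comm]
    refine Nat.add_le_add_right ?_ _
    rw [← Finset.card_image_of_injective _ (edge_inj ψ)]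
    refine Finset.card_le_card fun e he => ?_
    obtain ⟨u, hu, rfl⟩ := Finset.mem_image.1 he
    refine Finset.mem_sdiff.2 ⟨Finset.mem_image_of_mem _ (Finset.mem_univ u), fun h => ?_⟩
    obtain ⟨v, -, hv⟩ := Finset.mem_image.1 h
    refine (Finset.mem_filter.1 hu).2 ?_
    simp only [edge, Sym2.eq_iff] at hv
    rcases hv with h | h
    · exact ⟨v, h.1⟩
    · exact ⟨f v, h.2⟩
  have hsum (φ : V ↪ Fin n) : ∑ ψ : V ↪ Fin n, ∏ u, w φ (ψ u) ≤ (N + n * p : ℝ) ^ N := by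
    have s1 : ∑ ψ : V ↪ Fin n, ∏ u, w φ (ψ u) ≤ ∑ ψ : V → Fin n, ∏ u, w φ (ψ u) := by
      have : ∑ ψ : V ↪ Fin n, ∏ u, w φ (ψ u) =
          ∑ ψ ∈ (Finset.univ : Finset (V ↪ Fin n)).map
              ⟨fun (ψ : V ↪ Fin n) => (ψ : V → Fin n), DFunLike.coe_injective⟩,
            ∏ u, w φ (ψ u) := by
        rw [Finset.sum_map]; rfl
      rw [this]
      exact Finset.sum_le_sum_of_subset_of_nonneg (Finset.subset_univ _)
        fun ψ _ _ => Finset.prod_nonneg fun u _ => hw φ _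
    have s2 : ∑ ψ : V → Fin n, ∏ u, w φ (ψ u) = (∑ x, w φ x) ^ N := by
      have := Finset.prod_univ_sum (fun _ : V => (Finset.univ : Finset (Fin n)))
        (fun _ x => w φ x)
      rw [Finset.prod_const, Finset.card_univ] at this
      rw [this, Fintype.piFinset_univ]
    refine s1.trans (s2.le.trans (pow_le_pow_left₀ (Finset.sum_nonneg fun x _ => hw φ x) ?_ N))
    calc ∑ x, w φ x ≤ ∑ x : Fin n, ((if x ∈ Set.range φ then (1 : ℝ) else 0) + p) := by
          refine Finset.sum_le_sum fun x _ => ?_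
          simp only [w]; split_ifs <;> linarith
      _ = N + n * p := by
          rw [Finset.sum_add_distrib, Finset.sum_boole]
          have : (Finset.univ.filter fun x => x ∈ Set.range φ).card = N := by
            rw [hN, ← Finset.card_univ, ← Finset.card_map φ]
            congr 1; ext x; simp
          rw [this, Finset.sum_const, Finset.card_univ, Fintype.card_fin, nsmul_eq_mul]
  have key := sq_sum_measureReal_le (binomialRandom (Fin n) p) Finset.univ A
  have hU : (⋃ φ ∈ (Finset.univ : Finset (V ↪ Fin n)), A φ) =
      {G | ∃ φ : V ↪ Fin n, ∀ v, G.Adj (φ v) (φ (f v))} := by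
    ext G
    simp [A, E, edge]
  rw [hU] at key
  set P := (binomialRandom (Fin n) p).real {G | ∃ φ : V ↪ Fin n, ∀ v, G.Adj (φ v) (φ (f v))}
  set M : ℝ := (n.descFactorial N : ℝ) with hM
  have hcard : ((Finset.univ : Finset (V ↪ Fin n)).card : ℝ) = M := by
    rw [Finset.card_univ, Fintype.card_embedding_eq, Fintype.card_fin]
  have t1 : ∑ φ : V ↪ Fin n, (binomialRandom (Fin n) p).real (A φ) = M * p ^ N := by
    simp_rw [hA]
    rw [Finset.sum_const, nsmul_eq_mul, hcard]
  have t2 : ∑ φ : V ↪ Fin n, ∑ ψ : V ↪ Fin n, (binomialRandom (Fin n) p).real (A φ ∩ A ψ) ≤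
      M * (p ^ N * (N + n * p) ^ N) := by
    rw [← hcard, ← nsmul_eq_mul]
    refine Finset.sum_le_card_nsmul _ _ _ fun φ _ => ?_
    refine (Finset.sum_le_sum fun ψ _ => hAA φ ψ).trans ?_
    rw [← Finset.mul_sum]
    exact mul_le_mul_of_nonneg_left (hsum φ) (by positivity)
  have hP : 0 ≤ P := measureReal_nonneg
  rcases (show 0 ≤ M * (p : ℝ) ^ N by positivity).eq_or_lt with h | h
  · rw [← h]; positivity
  · refine le_of_mul_le_mul_left ?_ h
    calc M * (p : ℝ) ^ N * (M * p ^ N) = (M * p ^ N) ^ 2 := by ring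
      _ ≤ P * (M * (p ^ N * (N + n * p) ^ N)) := by
          rw [← t1]; exact key.trans (mul_le_mul_of_nonneg_left t2 hP)
      _ = _ := by ring

open MeasureTheory unitInterval in
/-- If `n p` is bounded away from zero, then so is the probability that `G(n, p)` contains a copy
of a given functional graph. -/
theorem exists_pos_le_binomialRandom_copy {V : Type*} [Fintype V] (f : V → V)
    (h1 : ∀ v, f v ≠ v) (h2 : ∀ v, f (f v) ≠ v) (p : ℕ → I) (c : ℝ) (hc : 0 < c)
    (hp : ∀ᶠ n : ℕ in atTop, c / (n : ℝ) ≤ (p n : ℝ)) :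
    ∃ δ : ℝ, 0 < δ ∧ ∀ᶠ n : ℕ in atTop, δ ≤ (binomialRandom (Fin n) (p n)).real
      {G | ∃ φ : V ↪ Fin n, ∀ v, G.Adj (φ v) (φ (f v))} := by
  set N := Fintype.card V with hN
  refine ⟨((c / 2) / (N + c)) ^ N, by positivity, ?_⟩
  filter_upwards [hp, eventually_ge_atTop (2 * N + 1)] with n hn hnN
  have hn0 : (0 : ℝ) < n := by exact_mod_cast (by omega : 0 < n)
  have hcn : c ≤ n * p n := by
    rw [div_le_iff₀ hn0] at hn; linarith
  have hp0 : (0 : ℝ) ≤ p n := (p n).2.1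
  have hpos : (0 : ℝ) < N + n * p n := by
    have : (0 : ℝ) ≤ N := Nat.cast_nonneg _
    linarith
  have key := descFactorial_mul_pow_le_binomialRandom f h1 h2 n (p n)
  rw [← hN] at key
  have hd : ((n : ℝ) / 2) ^ N ≤ n.descFactorial N := by
    have h : (n + 1 - N) ^ N ≤ n.descFactorial N := Nat.pow_sub_le_descFactorial n N
    refine le_trans ?_ (Nat.cast_le.2 h)
    rw [Nat.cast_pow]
    refine pow_le_pow_left₀ (by positivity) ?_ _
    have : n ≤ 2 * (n + 1 - N) := by omega
    have : (n : ℝ) ≤ 2 * ((n + 1 - N : ℕ) : ℝ) := by exact_mod_cast this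
    linarith
  have : (((n : ℝ) * p n / 2) / (N + n * p n)) ^ N ≤ (binomialRandom (Fin n) (p n)).real
      {G | ∃ φ : V ↪ Fin n, ∀ v, G.Adj (φ v) (φ (f v))} := by
    rw [div_pow, div_le_iff₀ (by positivity)]
    refine le_trans ?_ key
    rw [show ((n : ℝ) * p n / 2) = n / 2 * p n by ring, mul_pow]
    exact mul_le_mul_of_nonneg_right hd (by positivity)
  refine le_trans (pow_le_pow_left₀ (by positivity) ?_ _) this
  rw [div_le_div_iff₀ (by positivity) (by positivity)]
  have hN0 : (0 : ℝ) ≤ N := Nat.cast_nonneg _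
  nlinarith [mul_le_mul_of_nonneg_right hcn hN0]

end SimpleGraph

/-! ### Orientations with out-degrees at most one -/

namespace SimpleGraph

/-- `f` encodes an orientation of `G` with out-degrees at most one: the edges of `G` are the pairs
`v — f v` with `f v ≠ v`, and no edge is listed twice. Fixed points of `f` are the vertices of
out-degree zero. -/
structure IsFunctional {V : Type*} (G : SimpleGraph V) (f : V → V) : Prop where
  eq_or_eq_of_adj : ∀ {x y}, G.Adj x y → f x = y ∨ f y = x
  adj : ∀ {v}, f v ≠ v → G.Adj v (f v)
  eq_of_apply_apply : ∀ {v}, f (f v) = v → f v = v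

/-- By Hall's theorem, a graph all of whose subgraphs have at most as many edges as vertices has an
orientation with out-degrees at most one. -/
theorem exists_isFunctional {V : Type*} [Fintype V] [DecidableEq V] (G : SimpleGraph V)
    (h : ∀ (S : Finset V) (J : Finset (Sym2 V)), J ⊆ S.sym2 → (∀ e ∈ J, e ∈ G.edgeSet) →
      J.card ≤ S.card) : ∃ f : V → V, G.IsFunctional f := by
  classical
  obtain ⟨g, hg, hgm⟩ := (Finset.all_card_le_biUnion_card_iff_exists_injective
    (fun e : G.edgeSet => e.1.toFinset)).1 (fun s => by
      rw [← Finset.card_map (Function.Embedding.subtype _)]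
      refine h _ _ ?_ ?_
      · intro e he
        obtain ⟨e', he', rfl⟩ := Finset.mem_map.1 he
        rw [Finset.mem_sym2_iff]
        intro v hv
        exact Finset.mem_biUnion.2 ⟨e', he', Sym2.mem_toFinset.2 hv⟩
      · intro e he
        obtain ⟨e', he', rfl⟩ := Finset.mem_map.1 he
        exact e'.2)
  have hgm' (e : G.edgeSet) : g e ∈ e.1 := Sym2.mem_toFinset.1 (hgm e)
  have hex (v : V) : ∃ w, (∃ e : G.edgeSet, g e = v ∧ e.1 = s(v, w)) ∨
      ((¬ ∃ e, g e = v) ∧ w = v) := by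
    by_cases hv : ∃ e, g e = v
    · obtain ⟨e, rfl⟩ := hv
      obtain ⟨w, hw⟩ := hgm' e
      exact ⟨w, .inl ⟨e, rfl, hw⟩⟩
    · exact ⟨v, .inr ⟨hv, rfl⟩⟩
  choose f hf using hex
  have hfe (e : G.edgeSet) : e.1 = s(g e, f (g e)) := by
    rcases hf (g e) with ⟨e', h1, h2⟩ | ⟨h1, -⟩
    · rwa [hg h1] at h2
    · exact absurd ⟨e, rfl⟩ h1
  have hfne (v : V) (hv : f v ≠ v) : ∃ e : G.edgeSet, g e = v ∧ e.1 = s(v, f v) :=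
    (hf v).resolve_right fun h => hv h.2
  refine ⟨f, ?_, ?_, ?_⟩
  · intro x y hxy
    have := hfe ⟨s(x, y), hxy⟩
    simp only [Sym2.eq_iff] at this
    rcases this with ⟨h1, h2⟩ | ⟨h1, h2⟩
    · left; rw [h2, ← h1]
    · right; rw [h1, ← h2]
  · intro v hv
    obtain ⟨e, -, he⟩ := hfne v hv
    have := e.2
    rw [he] at this
    exact this
  · intro v hv
    by_contra hne
    obtain ⟨e, he, he'⟩ := hfne v hne
    obtain ⟨e₂, he₂, he₂'⟩ := hfne (f v) (by rw [hv]; exact Ne.symm hne)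
    rw [hv, Sym2.eq_swap, ← he'] at he₂'
    rw [Subtype.ext he₂'] at he₂
    exact hne (he₂.symm.trans he)

/-- The left-hand side bounds the expected number of pairs of a set of `s` vertices and a set of
`s + 1` edges among them; there are `(s + 1).choose 2` unordered pairs of vertices, loops
included. -/
theorem choose_mul_choose_mul_pow_le (n s : ℕ) (hn : 0 < n) (p : ℝ) (hp0 : 0 ≤ p)
    (hp : p ≤ (1 / 40) / n) :
    (n.choose s : ℝ) * (((s + 1).choose 2).choose (s + 1) * p ^ (s + 1)) ≤
      1 / (2 * n) * (1 / 2) ^ s := by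
  have hn' : (0 : ℝ) < n := by exact_mod_cast hn
  have h1 : (n.choose s : ℝ) ≤ n ^ s / s.factorial := Nat.choose_le_pow_div s n
  have h2 : (((s + 1).choose 2).choose (s + 1) : ℝ) ≤
      (s ^ 2 : ℝ) ^ (s + 1) / (s + 1).factorial := by
    refine (Nat.choose_le_pow_div (s + 1) _).trans ?_
    refine div_le_div_of_nonneg_right (pow_le_pow_left₀ (by positivity) ?_ _) (by positivity)
    have : (s + 1).choose 2 ≤ s ^ 2 := by
      rw [Nat.choose_two_right, Nat.add_sub_cancel]
      refine Nat.div_le_of_le_mul ?_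
      rcases s with _ | s
      · simp
      · nlinarith
    exact_mod_cast this
  have h3 : p ^ (s + 1) ≤ ((1 / 40) / n) ^ (s + 1) := pow_le_pow_left₀ hp0 hp _
  have e1 : (s : ℝ) ^ s / s.factorial ≤ Real.exp 1 ^ s := by
    rw [← Real.exp_nat_mul, mul_one]
    exact Real.pow_div_factorial_le_exp _ (by positivity) _
  have e2 : (s : ℝ) ^ (s + 1) / (s + 1).factorial ≤ Real.exp 1 ^ s := by
    rw [← Real.exp_nat_mul, mul_one]
    exact Real.pow_div_factorial_le_exp _ (by positivity) _
  have he : Real.exp 1 * Real.exp 1 ≤ 10 := by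
    nlinarith [Real.exp_one_lt_d9, Real.exp_pos 1]
  have hs : (s : ℝ) ≤ 2 ^ s := by exact_mod_cast Nat.lt_two_pow_self.le
  calc (n.choose s : ℝ) * (((s + 1).choose 2).choose (s + 1) * p ^ (s + 1))
      ≤ n ^ s / s.factorial * ((s ^ 2 : ℝ) ^ (s + 1) / (s + 1).factorial *
          ((1 / 40) / n) ^ (s + 1)) := by gcongr
    _ = 1 / (40 * n) * s * ((s : ℝ) ^ s / s.factorial * (s ^ (s + 1) / (s + 1).factorial)) *
          (1 / 40) ^ s := by
        rw [div_pow, div_pow, div_pow]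
        field_simp
        ring
    _ ≤ 1 / (40 * n) * 2 ^ s * (Real.exp 1 ^ s * Real.exp 1 ^ s) * (1 / 40) ^ s := by gcongr
    _ = 1 / (40 * n) * (2 * (Real.exp 1 * Real.exp 1) / 40) ^ s := by
        simp only [div_pow, mul_pow, one_pow]; ring
    _ ≤ 1 / (2 * n) * (1 / 2) ^ s := by
        refine mul_le_mul (by gcongr; norm_num) (pow_le_pow_left₀ (by positivity) ?_ _)
          (by positivity) (by positivity)
        linarith

open MeasureTheory unitInterval in
/-- For `p ≤ 1 / (40 n)`, every component of `G(n, p)` has at most one cycle, up to probability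
`1 / n`. -/
theorem binomialRandom_not_isFunctional_le (n : ℕ) (hn : 0 < n) (p : I)
    (hp : (p : ℝ) ≤ (1 / 40) / n) :
    (binomialRandom (Fin n) p).real {G | ¬ ∃ f, G.IsFunctional f} ≤ 1 / n := by
  classical
  have hp0 : (0 : ℝ) ≤ p := p.2.1
  let J : Finset (Fin n) → Finset (Finset (Sym2 (Fin n))) := fun S =>
    (S.sym2.powersetCard (S.card + 1)).filter fun J => ∀ e ∈ J, ¬ e.IsDiag
  have hsub : {G : SimpleGraph (Fin n) | ¬ ∃ f, G.IsFunctional f} ⊆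
      ⋃ S ∈ (Finset.univ : Finset (Finset (Fin n))), ⋃ j ∈ J S,
        {G | ∀ e ∈ j, e ∈ G.edgeSet} := by
    intro G hG
    by_contra hcon
    refine hG (exists_isFunctional G fun S j hj hje => ?_)
    by_contra! hlt
    obtain ⟨j', hj', hc⟩ := Finset.exists_subset_card_eq (Nat.succ_le_of_lt hlt)
    refine hcon (Set.mem_biUnion (Finset.mem_univ S) (Set.mem_biUnion (x := j') ?_ ?_))
    · exact Finset.mem_filter.2 ⟨Finset.mem_powersetCard.2 ⟨hj'.trans hj, hc⟩,
        fun e he => G.not_isDiag_of_mem_edgeSet (hje e (hj' he))⟩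
    · exact fun e he => hje e (hj' he)
  have hS (S : Finset (Fin n)) :
      (binomialRandom (Fin n) p).real (⋃ j ∈ J S, {G | ∀ e ∈ j, e ∈ G.edgeSet}) ≤
      (((S.card + 1).choose 2).choose (S.card + 1) * (p : ℝ) ^ (S.card + 1)) := by
    refine (measureReal_biUnion_finset_le _ _).trans ?_
    have : ∀ j ∈ J S, (binomialRandom (Fin n) p).real {G | ∀ e ∈ j, e ∈ G.edgeSet} =
        (p : ℝ) ^ (S.card + 1) := by
      intro j hj
      obtain ⟨h1, h2⟩ := Finset.mem_filter.1 hj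
      rw [binomialRandom_real_superset p j h2, (Finset.mem_powersetCard.1 h1).2]
    rw [Finset.sum_congr rfl this, Finset.sum_const, nsmul_eq_mul]
    refine mul_le_mul_of_nonneg_right ?_ (by positivity)
    rw [← Finset.card_sym2, ← Finset.card_powersetCard]
    exact_mod_cast Finset.card_filter_le _ _
  calc (binomialRandom (Fin n) p).real {G | ¬ ∃ f, G.IsFunctional f}
      ≤ ∑ S : Finset (Fin n),
          (((S.card + 1).choose 2).choose (S.card + 1) * (p : ℝ) ^ (S.card + 1)) :=
        (measureReal_mono hsub (measure_ne_top _ _)).trans ((measureReal_biUnion_finset_le _ _).trans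
          (Finset.sum_le_sum fun S _ => hS S))
    _ = ∑ s ∈ Finset.range (n + 1), (n.choose s : ℝ) *
          (((s + 1).choose 2).choose (s + 1) * (p : ℝ) ^ (s + 1)) := by
        have := Finset.sum_powerset_apply_card
          (fun s => (((s + 1).choose 2).choose (s + 1) * (p : ℝ) ^ (s + 1)))
          (x := (Finset.univ : Finset (Fin n)))
        rw [Finset.powerset_univ] at this
        rw [this]
        simp
    _ ≤ ∑ s ∈ Finset.range (n + 1), 1 / (2 * (n : ℝ)) * (1 / 2) ^ s :=
        Finset.sum_le_sum fun s _ => choose_mul_choose_mul_pow_le n s hn p hp0 hp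
    _ ≤ 1 / n := by
        rw [← Finset.mul_sum]
        have h : ∑ s ∈ Finset.range (n + 1), (1 / 2 : ℝ) ^ s ≤ 2 := by
          have := sum_geometric_two_le (n + 1)
          simpa using this
        calc 1 / (2 * (n : ℝ)) * _ ≤ 1 / (2 * (n : ℝ)) * 2 := by gcongr
          _ = 1 / n := by field_simp

end SimpleGraph

/-! ### List colourings along a self-map -/

/-- Greedy list colouring along a self-map `f`: if every forward orbit meets `R`, then any
colouring of `R` extends to a colouring from lists of size at least two in which every point
outside `R` is coloured differently from its image. -/
theorem exists_listColoring_of_orbits_meet {V : Type*} (f : V → V) (R : Set V)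
    (hR : ∀ v, ∃ k, f^[k] v ∈ R) (ρ : V → ℕ) (L : V → Finset ℕ) (hL : ∀ v, 2 ≤ (L v).card) :
    ∃ χ : V → ℕ, (∀ v ∈ R, χ v = ρ v) ∧ ∀ v, v ∉ R → χ v ∈ L v ∧ χ v ≠ χ (f v) := by
  classical
  choose pick hpick using fun (v : V) (c : ℕ) => (L v).exists_mem_ne (hL v) c
  -- `g k v` is the correct colour of `v` as soon as the orbit of `v` meets `R` within `k` steps
  let g : ℕ → V → ℕ := fun k => Nat.rec ρ (fun _ h v => if v ∈ R then ρ v else pick v (h (f v))) k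
  have g_succ (k : ℕ) (v : V) (hv : v ∉ R) : g (k + 1) v = pick v (g k (f v)) := if_neg hv
  have g_mem (k : ℕ) (v : V) (hv : v ∈ R) : g k v = ρ v := by
    cases k with
    | zero => rfl
    | succ k => exact if_pos hv
  refine ⟨fun v => g (Nat.find (hR v)) v, fun v hv => g_mem _ _ hv, fun v hv => ?_⟩
  have hd : Nat.find (hR v) = Nat.find (hR (f v)) + 1 :=
    Nat.find_comp_succ (hR v) (hR (f v)) hv
  simp only [hd]
  rw [g_succ _ _ hv]
  exact hpick v _

/-- A self-map of which every orbit meets a set `Q` of periodic points has a transversal of its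
components consisting of points of `Q`. -/
theorem exists_transversal_of_orbits_meet {V : Type*} (f : V → V) (Q : V → Prop)
    (hQ : ∀ v, ∃ k, Q (f^[k] v)) (hper : ∀ v, Q v → v ∈ Function.periodicPts f) :
    ∃ R : Set V, (∀ v ∈ R, Q v) ∧ (∀ v, ∃ k, f^[k] v ∈ R) ∧
      ∀ y ∈ R, ∀ w ∈ R, ∀ j k, f^[j] y = f^[k] w → y = w := by
  let s : Setoid V :=
    { r := fun u v => ∃ j k, f^[j] u = f^[k] v
      iseqv :=
        { refl := fun u => ⟨0, 0, rfl⟩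
          symm := fun ⟨j, k, h⟩ => ⟨k, j, h.symm⟩
          trans := by
            rintro u v w ⟨j, k, h⟩ ⟨j', k', h'⟩
            refine ⟨j' + j, k + k', ?_⟩
            rw [Function.iterate_add_apply, h, ← Function.iterate_add_apply, Nat.add_comm j' k,
              Function.iterate_add_apply, h', ← Function.iterate_add_apply] } }
  have hrep (q : Quotient s) : ∃ p : V, Quotient.mk s p = q ∧ Q p := by
    obtain ⟨k, hk⟩ := hQ q.out
    refine ⟨f^[k] q.out, ?_, hk⟩
    conv_rhs => rw [← Quotient.out_eq q]
    exact Quotient.sound ⟨0, k, rfl⟩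
  choose rep hrep hrepQ using hrep
  refine ⟨Set.range rep, ?_, fun v => ?_, ?_⟩
  · rintro _ ⟨q, rfl⟩; exact hrepQ q
  · obtain ⟨j, k, h⟩ := Quotient.exact (hrep (Quotient.mk s v))
    obtain ⟨m, hm, hmp⟩ := hper _ (hrepQ (Quotient.mk s v))
    refine ⟨m * j - j + k, Quotient.mk s v, ?_⟩
    rw [Function.iterate_add_apply, ← h, ← Function.iterate_add_apply,
      Nat.sub_add_cancel (Nat.le_mul_of_pos_left j hm)]
    exact (hmp.mul_const j).symm
  · rintro _ ⟨q, rfl⟩ _ ⟨q', rfl⟩ j k h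
    have : Quotient.mk s (rep q) = Quotient.mk s (rep q') := Quotient.sound ⟨j, k, h⟩
    rw [hrep, hrep] at this
    rw [this]

theorem exists_iterate_mem_periodicPts {V : Type*} [Finite V] (f : V → V) (v : V) :
    ∃ k, f^[k] v ∈ Function.periodicPts f := by
  obtain ⟨i, j, hne, hij⟩ := Finite.exists_ne_map_eq_of_infinite fun k : ℕ => f^[k] v
  wlog hlt : i < j generalizing i j
  · exact this j i hne.symm hij.symm (by omega)
  refine ⟨i, Function.mk_mem_periodicPts (n := j - i) (by omega) ?_⟩
  change f^[j - i] (f^[i] v) = f^[i] v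
  rw [← Function.iterate_add_apply, Nat.sub_add_cancel hlt.le]
  exact hij.symm

/-- With lists of size three, one removes the colour of each point of the transversal from the list
of its image and then colours greedily, so that no conflict arises on the cycles. -/
theorem exists_listColoring_of_three_le {V : Type*} [Finite V] (f : V → V) (L : V → Finset ℕ)
    (hL : ∀ v, 3 ≤ (L v).card) :
    ∃ χ : V → ℕ, (∀ v, χ v ∈ L v) ∧ ∀ v, f v ≠ v → χ v ≠ χ (f v) := by
  classical
  obtain ⟨R, -, hR1, hR2⟩ := exists_transversal_of_orbits_meet f (· ∈ Function.periodicPts f)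
    (exists_iterate_mem_periodicPts f) (fun _ h => h)
  have hne (v : V) : ∃ a, a ∈ L v := Finset.card_pos.1 (by have := hL v; omega)
  choose ρ hρ using hne
  obtain ⟨χ, h1, h2⟩ := exists_listColoring_of_orbits_meet f R hR1 ρ
    (fun v => (L v).filter fun c => ∀ u ∈ R, f u = v → c ≠ ρ u) (fun v => by
      by_cases h : ∃ u ∈ R, f u = v
      · obtain ⟨u, hu, rfl⟩ := h
        have : (L (f u)).erase (ρ u) ⊆
            (L (f u)).filter fun c => ∀ u' ∈ R, f u' = f u → c ≠ ρ u' := by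
          intro c hc
          refine Finset.mem_filter.2 ⟨Finset.mem_of_mem_erase hc, fun u' hu' he => ?_⟩
          rw [hR2 u' hu' u hu 1 1 he]
          exact Finset.ne_of_mem_erase hc
        refine le_trans ?_ (Finset.card_le_card this)
        have := Finset.pred_card_le_card_erase (s := L (f u)) (a := ρ u)
        have := hL (f u)
        omega
      · rw [Finset.filter_true_of_mem]
        · have := hL v; omega
        · exact fun c _ u hu he => absurd ⟨u, hu, he⟩ h)
  refine ⟨χ, fun v => ?_, fun v hv => ?_⟩
  · by_cases h : v ∈ R
    · rw [h1 v h]; exact hρ v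
    · exact (Finset.mem_filter.1 (h2 v h).1).1
  · by_cases h : v ∈ R
    · have hf : f v ∉ R := fun hf => hv (hR2 _ hf v h 0 1 rfl)
      rw [h1 v h]
      exact ((Finset.mem_filter.1 (h2 _ hf).1).2 v h rfl).symm
    · exact (h2 v h).2

/-- Colouring greedily from a transversal leaves at most one conflict in each component. -/
theorem exists_listColoring_conflicts_separated {V : Type*} [Finite V] (f : V → V)
    (L : V → Finset ℕ) (hL : ∀ v, 2 ≤ (L v).card) :
    ∃ χ : V → ℕ, (∀ v, χ v ∈ L v) ∧
      ∀ y w, f y ≠ y → χ y = χ (f y) → f w ≠ w → χ w = χ (f w) →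
        ∀ j k, f^[j] y = f^[k] w → y = w := by
  obtain ⟨R, -, hR1, hR2⟩ := exists_transversal_of_orbits_meet f (· ∈ Function.periodicPts f)
    (exists_iterate_mem_periodicPts f) (fun _ h => h)
  have hne (v : V) : ∃ a, a ∈ L v := Finset.card_pos.1 (by have := hL v; omega)
  choose ρ hρ using hne
  obtain ⟨χ, h1, h2⟩ := exists_listColoring_of_orbits_meet f R hR1 ρ L hL
  have hmem (v : V) (h : χ v = χ (f v)) : v ∈ R := by
    by_contra hv
    exact (h2 v hv).2 h
  refine ⟨χ, fun v => ?_, fun y w _ hy _ hw => hR2 y (hmem y hy) w (hmem w hw)⟩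
  by_cases h : v ∈ R
  · rw [h1 v h]; exact hρ v
  · exact (h2 v h).1

/-- With lists of size two, a cycle can be coloured without conflicts unless it is odd and all its
lists are equal; such cycles are coloured with a single colour. -/
theorem exists_listColoring_conflicts_odd {V : Type*} [Finite V] (f : V → V) (L : V → Finset ℕ)
    (hL : ∀ v, (L v).card = 2) :
    ∃ χ : V → ℕ, (∀ v, χ v ∈ L v) ∧
      ∀ w, f w ≠ w → χ w = χ (f w) →
        Odd (Function.minimalPeriod f w) ∧ ∀ k, χ (f^[k] w) = χ w := by
  classical
  -- where the list differs from the next one, a cycle can be closed up without a conflict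
  let P : V → Prop := fun v => ∃ a, a ∈ L v ∧ a ∉ L (f v)
  obtain ⟨R, hRQ, hR1, hR2⟩ := exists_transversal_of_orbits_meet f
    (fun p => p ∈ Function.periodicPts f ∧ ((∃ k, P (f^[k] p)) → P p))
    (fun v => by
      obtain ⟨i, hi⟩ := exists_iterate_mem_periodicPts f v
      by_cases h : ∃ k, P (f^[k] (f^[i] v))
      · obtain ⟨k, hk⟩ := h
        refine ⟨k + i, ?_⟩
        rw [Function.iterate_add_apply]
        refine ⟨?_, fun _ => hk⟩
        obtain ⟨m, hm, hmp⟩ := hi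
        exact ⟨m, hm, hmp.apply_iterate k⟩
      · exact ⟨i, hi, fun h' => absurd h' h⟩)
    (fun _ h => h.1)
  have hne (v : V) : (L v).Nonempty := Finset.card_pos.1 (by rw [hL v]; omega)
  let ρ : V → ℕ := fun v => if h : P v then h.choose else sInf (L v : Set ℕ)
  have hρ (v : V) : ρ v ∈ L v := by
    simp only [ρ]
    split_ifs with h
    · exact h.choose_spec.1
    · exact Nat.sInf_mem (s := (L v : Set ℕ)) (hne v)
  have hρP (v : V) (h : P v) : ρ v ∉ L (f v) := by
    simp only [ρ, dif_pos h]
    exact h.choose_spec.2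
  have hconst (p : V) (hp : p ∈ R) (hP : ¬ P p) (k : ℕ) : L (f^[k] p) = L p := by
    induction k with
    | zero => rfl
    | succ k ih =>
      rw [← ih, Function.iterate_succ_apply']
      symm
      refine Finset.eq_of_subset_of_card_le (fun a ha => ?_) (by rw [hL, hL])
      by_contra hcon
      exact hP ((hRQ p hp).2 ⟨k, a, ha, hcon⟩)
  have hρconst (p : V) (hp : p ∈ R) (hP : ¬ P p) (k : ℕ) : ρ (f^[k] p) = ρ p := by
    have : ¬ P (f^[k] p) := fun h => hP ((hRQ p hp).2 ⟨k, h⟩)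
    simp only [ρ, dif_neg this, dif_neg hP, hconst p hp hP k]
  let R' : Set V := {v | v ∈ R ∨ ∃ p ∈ R, ¬ P p ∧ Odd (Function.minimalPeriod f p) ∧
    ∃ k, v = f^[k] p}
  obtain ⟨χ, h1, h2⟩ := exists_listColoring_of_orbits_meet f R'
    (fun v => (hR1 v).imp fun k hk => Or.inl hk) ρ L (fun v => (hL v).ge)
  have hχ (v : V) : χ v ∈ L v := by
    by_cases h : v ∈ R'
    · rw [h1 v h]; exact hρ v
    · exact (h2 v h).1
  refine ⟨χ, hχ, fun w hw hbad => ?_⟩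
  have hwR' : w ∈ R' := by
    by_contra h
    exact (h2 w h).2 hbad
  by_cases hcyc : ∃ p ∈ R, ¬ P p ∧ Odd (Function.minimalPeriod f p) ∧ ∃ k, w = f^[k] p
  · obtain ⟨p, hp, hP, hodd, k, rfl⟩ := hcyc
    have hc (j : ℕ) : χ (f^[j] p) = ρ p := by
      rw [h1 _ (Or.inr ⟨p, hp, hP, hodd, j, rfl⟩), hρconst p hp hP]
    refine ⟨?_, fun j => ?_⟩
    · rwa [Function.minimalPeriod_apply_iterate (hRQ p hp).1]
    · rw [← Function.iterate_add_apply, hc, hc]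
  exfalso
  have hwR : w ∈ R := hwR'.resolve_right hcyc
  by_cases hP : P w
  · refine hρP w hP ?_
    rw [← h1 w hwR', hbad]
    exact hχ _
  -- the cycle is even with equal lists: the greedy colouring alternates
  set m := Function.minimalPeriod f w with hm
  have hm0 : 0 < m := Function.minimalPeriod_pos_of_mem_periodicPts (hRQ w hwR).1
  have hnot : ¬ Odd m := fun h => hcyc ⟨w, hwR, hP, h, 0, rfl⟩
  have hstep (k : ℕ) (hk : 1 ≤ k) (hkm : k < m) : χ (f^[k] w) ≠ χ (f^[k + 1] w) := by
    rw [Function.iterate_succ_apply']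
    refine (h2 _ ?_).2
    rintro (h | ⟨p, hp, hPp, hodd, j, hj⟩)
    · have := hR2 _ h w hwR 0 k rfl
      exact Function.not_isPeriodicPt_of_pos_of_lt_minimalPeriod (by omega) hkm this
    · exact hcyc ⟨p, hp, hPp, hodd, 0, hR2 w hwR p hp k j hj⟩
  obtain ⟨a, b, -, hab⟩ := Finset.card_eq_two.1 (hL w)
  have hval (k : ℕ) : χ (f^[k] w) = a ∨ χ (f^[k] w) = b := by
    have := hχ (f^[k] w)
    rw [hconst w hwR hP k, hab] at this
    simpa using this
  have halt (k : ℕ) (hk : 1 ≤ k) (hkm : k ≤ m) : χ (f^[k] w) = χ (f w) ↔ Odd k := by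
    induction k, hk using Nat.le_induction with
    | base => simp
    | succ k hk ih =>
      have ih := ih (by omega)
      have hs := hstep k hk (by omega)
      rw [Nat.odd_add_one, ← ih]
      have v1 := hval k
      have v2 := hval (k + 1)
      have v3 := hval 1
      rw [Function.iterate_one] at v3
      omega
  refine hnot ((halt m hm0 le_rfl).1 ?_)
  rw [hm, Function.iterate_minimalPeriod, hbad]

/-! ### Colour classes of functional graphs -/

namespace SimpleGraph

/-- An embedded component stays inside any set that is closed under adjacency and that it meets. -/
theorem ConnectedComponent.isContained_induce_of_closed {V W : Type*} {H : SimpleGraph V}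
    {F : SimpleGraph W} (φ : F.Copy H) (T : Set V) (hT : ∀ x ∈ T, ∀ y, H.Adj x y → y ∈ T)
    (x₀ : W) (hx₀ : φ x₀ ∈ T) :
    (F.connectedComponentMk x₀).toSimpleGraph.IsContained (H.induce T) := by
  have hwalk {x y : W} (p : F.Walk x y) : φ x ∈ T → φ y ∈ T := by
    induction p with
    | nil => exact id
    | cons h p ih => exact fun hx => ih (hT _ hx _ (φ.toHom.map_adj h))
  have hmem (y : W) (hy : y ∈ (F.connectedComponentMk x₀).supp) : φ y ∈ T := by
    obtain ⟨p⟩ := (ConnectedComponent.eq.1 hy).symm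
    exact hwalk p hx₀
  refine ⟨⟨⟨fun y => ⟨φ y.1, hmem y.1 y.2⟩, fun {a b} h => φ.toHom.map_adj h⟩, ?_⟩⟩
  intro a b hab
  exact Subtype.ext (φ.injective (Subtype.ext_iff.1 hab))

theorem Connected.isStar_of_isContained {V W : Type*} {K : SimpleGraph W} (hK : K.Connected)
    {c : V} (h : K.IsContained (starGraph c)) : K.IsStar := by
  obtain ⟨ψ⟩ := h
  have hadj {x y : W} (hxy : K.Adj x y) : ψ x = c ∨ ψ y = c :=
    (starGraph_adj.1 (ψ.toHom.map_adj hxy)).2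
  have hinj {x y : W} (hxy : ψ x = ψ y) : x = y := ψ.injective hxy
  have hnbr {x y : W} (hxy : x ≠ y) : ∃ z, K.Adj x z := by
    have : Nontrivial W := ⟨x, y, hxy⟩
    exact hK.preconnected.exists_adj_of_nontrivial x
  obtain ⟨k, hk⟩ : ∃ k, ∀ x, ψ x = c → x = k := by
    by_cases hc : ∃ k, ψ k = c
    · obtain ⟨k, hk⟩ := hc
      exact ⟨k, fun x hx => hinj (hx.trans hk.symm)⟩
    · exact ⟨hK.nonempty.some, fun x hx => absurd ⟨x, hx⟩ hc⟩
  have hto {x : W} (hx : x ≠ k) : K.Adj x k := by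
    obtain ⟨z, hz⟩ := hnbr hx
    rcases hadj hz with h | h
    · exact absurd (hk x h) hx
    · rwa [← hk z h]
  refine ⟨k, ?_⟩
  ext x y
  rw [starGraph_adj]
  constructor
  · exact fun hxy => ⟨hxy.ne, (hadj hxy).imp (hk x) (hk y)⟩
  · rintro ⟨hne, rfl | rfl⟩
    · exact (hto hne.symm).symm
    · exact hto hne

/-- Let all edges of `H` be of the form `v — f v` with `v ∈ A`. Then `x` lies in an in-star of `f`
that is closed under adjacency in `H`, unless there is a conflict close to `x`: a point `w ∈ A`
with `f w ∈ A` such that `x` is `w`, or `f (f w)`, or attached to `f (f w)`. The last case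
includes `x = f w`. -/
theorem exists_star_or_conflict {V : Type*} {f : V → V} {A : Set V} {H : SimpleGraph V}
    (hH : ∀ x y, H.Adj x y → (x ∈ A ∧ f x = y) ∨ (y ∈ A ∧ f y = x)) (x : V) :
    (∃ T : Set V, x ∈ T ∧ (∀ y ∈ T, ∀ z, H.Adj y z → z ∈ T) ∧
      ∃ c : T, (H.induce T).IsContained (starGraph c)) ∨
    ∃ w ∈ A, f w ∈ A ∧ (x = w ∨ x = f (f w) ∨ (x ∈ A ∧ f x = f (f w))) := by
  classical
  by_cases hcon : ∃ w ∈ A, f w ∈ A ∧ (x = w ∨ x = f (f w) ∨ (x ∈ A ∧ f x = f (f w)))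
  · exact Or.inr hcon
  refine Or.inl ?_
  -- the centre of the star is `f x` or `x`
  obtain ⟨c, hc⟩ : ∃ c, (x ∈ A ∧ f x = c) ∨ (x ∉ A ∧ x = c) := by
    by_cases hx : x ∈ A
    · exact ⟨f x, .inl ⟨hx, rfl⟩⟩
    · exact ⟨x, .inr ⟨hx, rfl⟩⟩
  have hcA : c ∉ A := by
    intro h
    rcases hc with ⟨hx, rfl⟩ | ⟨hx, rfl⟩
    · exact hcon ⟨x, hx, h, .inl rfl⟩
    · exact hx h
  have hno (u w : V) (hu : u ∈ A) (huc : f u = c) (hw : w ∈ A) (hwu : f w = u) : False := by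
    subst hwu
    refine hcon ⟨w, hw, hu, ?_⟩
    rcases hc with ⟨hx, rfl⟩ | ⟨hx, rfl⟩
    · exact .inr (.inr ⟨hx, huc.symm⟩)
    · exact .inr (.inl huc.symm)
  let T : Set V := {u | u = c ∨ (u ∈ A ∧ f u = c)}
  refine ⟨T, ?_, ?_, ⟨c, .inl rfl⟩, IsContained.of_le ?_⟩
  · rcases hc with hc | ⟨-, hc⟩
    · exact .inr hc
    · exact .inl hc
  · rintro y (rfl | ⟨hy, hyc⟩) z hyz
    · rcases hH _ _ hyz with ⟨h, -⟩ | h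
      · exact absurd h hcA
      · exact .inr h
    · rcases hH _ _ hyz with ⟨-, h⟩ | ⟨h, h'⟩
      · exact .inl (h.symm.trans hyc)
      · exact (hno y z hy hyc h h').elim
  · rintro ⟨y, hy⟩ ⟨z, hz⟩ hyz
    have hyz' : H.Adj y z := hyz
    rw [starGraph_adj]
    refine ⟨hyz.ne, ?_⟩
    simp only [Subtype.mk.injEq]
    rcases hy with rfl | ⟨hy, hyc⟩
    · exact .inl rfl
    rcases hz with rfl | ⟨hz, hzc⟩
    · exact .inr rfl
    rcases hH _ _ hyz' with ⟨-, h⟩ | ⟨-, h⟩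
    · exact .inr (h.symm.trans hyc)
    · exact .inl (h.symm.trans hzc)

/-- If `w — f w — f (f w)` is the only path of two edges of `H` along `f` in its component, then
that component is a broom. -/
theorem exists_broom_of_conflict {V : Type*} [Finite V] {f : V → V} {A : Set V}
    {H : SimpleGraph V} (hf : ∀ v, f (f v) = v → f v = v) (hA : ∀ v ∈ A, f v ≠ v)
    (hH : ∀ x y, H.Adj x y → (x ∈ A ∧ f x = y) ∨ (y ∈ A ∧ f y = x))
    (hsep : ∀ y ∈ A, f y ∈ A → ∀ w ∈ A, f w ∈ A → ∀ j k, f^[j] y = f^[k] w → y = w)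
    (w : V) (hw : w ∈ A) (hfw : f w ∈ A) (x : V)
    (hx : x = w ∨ x = f (f w) ∨ (x ∈ A ∧ f x = f (f w))) :
    ∃ T : Set V, x ∈ T ∧ (∀ y ∈ T, ∀ z, H.Adj y z → z ∈ T) ∧
      ∃ b, (H.induce T).IsContained (broom b) := by
  classical
  have hffw : f (f w) ∉ A := fun h => hA w hw (hsep (f w) hfw h w hw hfw 0 1 rfl)
  have hne : f (f w) ≠ w := fun h => hA w hw (hf w h)
  have hne' : f (f w) ≠ f w := hA _ hfw
  let T : Set V := {u | u = w ∨ u = f (f w) ∨ (u ∈ A ∧ f u = f (f w))}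
  obtain ⟨b, ⟨e⟩⟩ := Finite.exists_equiv_fin V
  let ψ : V → Fin 3 ⊕ Fin b := fun u =>
    if u = w then .inl 0 else if u = f w then .inl 1 else if u = f (f w) then .inl 2 else .inr (e u)
  have ψ0 : ψ w = .inl 0 := if_pos rfl
  have ψ1 : ψ (f w) = .inl 1 := by simp [ψ, hA w hw]
  have ψ2 : ψ (f (f w)) = .inl 2 := by simp [ψ, hne, hne']
  have hψinj : Function.Injective ψ := by
    intro u v huv
    simp only [ψ] at huv
    split_ifs at huv <;> simp_all
  have hψ (u v : V) (hu : u ∈ T) (huA : u ∈ A) (huv : f u = v) : (broom b).Adj (ψ u) (ψ v) := by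
    subst huv
    refine (fromEdgeSet_adj _).2 ⟨?_, fun h => hA u huA (hψinj h).symm⟩
    rcases hu with rfl | rfl | ⟨-, hu⟩
    · rw [ψ0, ψ1]; simp
    · exact absurd huA hffw
    · rw [hu, ψ2]
      by_cases h1 : u = f w
      · rw [h1, ψ1]; simp
      · have h0 : u ≠ w := by
          rintro rfl
          exact hne' hu.symm
        have h2 : u ≠ f (f w) := fun h => hffw (h ▸ huA)
        have : ψ u = .inr (e u) := by simp only [ψ, if_neg h0, if_neg h1, if_neg h2]
        rw [this]
        exact .inr ⟨e u, Sym2.eq_swap⟩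
  refine ⟨T, hx, ?_, b, ⟨⟨⟨fun u => ψ u.1, ?_⟩, ?_⟩⟩⟩
  · intro y hy z hyz
    rcases hH _ _ hyz with ⟨hyA, rfl⟩ | ⟨hzA, rfl⟩
    · rcases hy with rfl | rfl | ⟨-, hy⟩
      · exact .inr (.inr ⟨hfw, rfl⟩)
      · exact absurd hyA hffw
      · exact .inr (.inl hy)
    · rcases hy with hy | hy | ⟨hyA, hy⟩
      · have := hsep z hzA (by rwa [hy]) w hw hfw 1 0 hy
        exact absurd (this ▸ hy) (hA w hw)
      · exact .inr (.inr ⟨hzA, hy⟩)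
      · exact .inl (hsep z hzA hyA w hw hfw 2 2 hy)
  · rintro ⟨u, hu⟩ ⟨v, hv⟩ huv
    rcases hH _ _ (show H.Adj u v from huv) with ⟨h, h'⟩ | ⟨h, h'⟩
    · exact hψ u v hu h h'
    · exact (hψ v u hv h h').symm
  · intro u v huv
    exact Subtype.ext (hψinj huv)

/-- If conflicts only occur on odd cycles of `f` contained in `A`, then the component of a conflict
is an odd cycle. -/
theorem exists_oddCycle_of_conflict {V : Type*} {f : V → V} {A : Set V}
    {H : SimpleGraph V} (hA : ∀ v ∈ A, f v ≠ v)
    (hH : ∀ x y, H.Adj x y → (x ∈ A ∧ f x = y) ∨ (y ∈ A ∧ f y = x))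
    (hcyc : ∀ w ∈ A, f w ∈ A → Odd (Function.minimalPeriod f w) ∧ ∀ k, f^[k] w ∈ A)
    (w : V) (hw : w ∈ A) (hfw : f w ∈ A) (x : V)
    (hx : x = w ∨ x = f (f w) ∨ (x ∈ A ∧ f x = f (f w))) :
    ∃ T : Set V, x ∈ T ∧ (∀ y ∈ T, ∀ z, H.Adj y z → z ∈ T) ∧
      ∃ l, 1 ≤ l ∧ (H.induce T).IsContained (cycleGraph (2 * l + 1)) := by
  obtain ⟨⟨l, hl⟩, hk⟩ := hcyc w hw hfw
  have hl1 : 1 ≤ l := by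
    by_contra h
    have : l = 0 := by omega
    subst this
    exact hA w hw (Function.minimalPeriod_eq_one_iff_isFixedPt.1 hl)
  let T : Set V := {u | ∃ k, u = f^[k] w}
  have hTA {u : V} (hu : u ∈ T) : u ∈ A := by
    obtain ⟨k, rfl⟩ := hu; exact hk k
  have hTf {u : V} (hu : u ∈ T) : f u ∈ T := by
    obtain ⟨k, rfl⟩ := hu
    exact ⟨k + 1, (Function.iterate_succ_apply' f k w).symm⟩
  -- a point of `A` whose image is on the cycle is itself on the cycle, since it is periodic
  have hTback {u : V} (hu : u ∈ A) (hfu : f u ∈ T) : u ∈ T := by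
    obtain ⟨⟨m, hm⟩, -⟩ := hcyc u hu (hTA hfu)
    obtain ⟨k, hk⟩ := hfu
    refine ⟨2 * m + k, ?_⟩
    rw [Function.iterate_add_apply, ← hk, ← Function.iterate_succ_apply]
    have := Function.iterate_minimalPeriod (f := f) (x := u)
    rw [hm] at this
    exact this.symm
  have hidx (u : T) : ∃ k : Fin (2 * l + 1), u.1 = f^[k] w := by
    obtain ⟨u, k, rfl⟩ := u
    refine ⟨⟨k % (2 * l + 1), Nat.mod_lt _ (by omega)⟩, ?_⟩
    simp only
    rw [← hl, Function.iterate_mod_minimalPeriod_eq]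
  choose ψ hψ using hidx
  have hψadj (u v : T) (huv : f u = v) : (cycleGraph (2 * l + 1)).Adj (ψ u) (ψ v) := by
    have h3 : (ψ v : ℕ) = (ψ u + 1) % (2 * l + 1) := by
      rw [hψ u, hψ v, ← Function.iterate_succ_apply' f _ w,
        ← Function.iterate_mod_minimalPeriod_eq (n := Nat.succ _), hl] at huv
      refine ((Function.iterate_eq_iterate_iff_of_lt_minimalPeriod ?_ ?_).1 huv).symm
      · rw [hl]; exact Nat.mod_lt _ (by omega)
      · rw [hl]; exact (ψ v).2
    rw [cycleGraph_adj']
    right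
    rw [Fin.val_sub]
    have h1 := (ψ u).2
    have h2 := (ψ v).2
    rcases Nat.lt_or_ge ((ψ u : ℕ) + 1) (2 * l + 1) with h | h
    · rw [Nat.mod_eq_of_lt h] at h3
      rw [h3, show 2 * l + 1 - (ψ u : ℕ) + (ψ u + 1) = 1 + (2 * l + 1) by omega, Nat.add_mod_right]
      exact Nat.mod_eq_of_lt (by omega)
    · have h4 : (ψ u : ℕ) + 1 = 2 * l + 1 := by omega
      rw [h4, Nat.mod_self] at h3
      rw [h3, show 2 * l + 1 - (ψ u : ℕ) + 0 = 1 by omega]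
      exact Nat.mod_eq_of_lt (by omega)
  refine ⟨T, ?_, ?_, l, hl1, ⟨⟨⟨ψ, ?_⟩, ?_⟩⟩⟩
  · rcases hx with rfl | rfl | ⟨hx, hx'⟩
    · exact ⟨0, rfl⟩
    · exact ⟨2, rfl⟩
    · exact hTback hx ⟨2, hx'⟩
  · intro y hy z hyz
    rcases hH _ _ hyz with ⟨-, rfl⟩ | ⟨hz, rfl⟩
    · exact hTf hy
    · exact hTback hz hy
  · intro u v huv
    rcases hH _ _ (show H.Adj u v from huv) with ⟨-, h⟩ | ⟨-, h⟩
    · exact hψadj u v h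
    · exact (hψadj v u h).symm
  · intro u v huv
    exact Subtype.ext ((hψ u).trans (by rw [show ψ u = ψ v from huv]; exact (hψ v).symm))

/-- A list colouring `χ` of the vertices of a functional graph colours the edge `v — f v` with
`χ v`. -/
theorem IsFunctional.exists_edgeLabeling {V : Type*} {G : SimpleGraph V} {f : V → V}
    (hG : G.IsFunctional f) {r : ℕ} (L : G.edgeSet → Finset ℕ) (hL : ∀ e, (L e).card = r) :
    ∃ L' : V → Finset ℕ, (∀ v, (L' v).card = r) ∧ ∀ χ : V → ℕ, (∀ v, χ v ∈ L' v) →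
      ∃ κ : G.EdgeLabeling ℕ, (∀ e, κ e ∈ L e) ∧ ∀ a x y, (κ.labelGraph a).Adj x y →
        (x ∈ {v | χ v = a ∧ f v ≠ v} ∧ f x = y) ∨ (y ∈ {v | χ v = a ∧ f v ≠ v} ∧ f y = x) := by
  classical
  have htail (e : G.edgeSet) : ∃ v, f v ≠ v ∧ e.1 = s(v, f v) := by
    obtain ⟨e, he⟩ := e
    induction e with
    | _ x y =>
      have hxy : G.Adj x y := he
      rcases hG.eq_or_eq_of_adj hxy with rfl | rfl
      · exact ⟨x, hxy.ne.symm, rfl⟩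
      · exact ⟨y, hxy.ne, Sym2.eq_swap⟩
  choose t ht hte using htail
  refine ⟨fun v => if h : f v ≠ v then L ⟨s(v, f v), hG.adj h⟩ else Finset.range r, ?_, ?_⟩
  · intro v
    dsimp only
    split_ifs
    · exact hL _
    · simp
  · intro χ hχ
    refine ⟨fun e => χ (t e), fun e => ?_, ?_⟩
    · have h := hχ (t e)
      dsimp only at h
      rw [dif_pos (ht e)] at h
      have : (⟨s(t e, f (t e)), hG.adj (ht e)⟩ : G.edgeSet) = e := Subtype.ext (hte e).symm
      rwa [this] at h
    · intro a x y hxy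
      obtain ⟨h, hc⟩ := (EdgeLabeling.labelGraph_adj x y).1 hxy
      have h1 := hte ⟨s(x, y), h⟩
      have h2 := ht ⟨s(x, y), h⟩
      have hc' : χ (t ⟨s(x, y), h⟩) = a := hc
      generalize t ⟨s(x, y), h⟩ = v at h1 h2 hc'
      rcases Sym2.eq_iff.1 h1 with ⟨rfl, h4⟩ | ⟨h4, rfl⟩
      · exact .inl ⟨⟨hc', h2⟩, h4.symm⟩
      · exact .inr ⟨⟨hc', h2⟩, h4.symm⟩

end SimpleGraph

/-! ### Non-exceptional families -/

namespace SimpleGraph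

theorem starGraph_isContained_broom {V : Type*} [Finite V] (c : V) :
    ∃ b, (starGraph c).IsContained (broom b) := by
  classical
  obtain ⟨b, ⟨e⟩⟩ := Finite.exists_equiv_fin V
  let ψ : V → Fin 3 ⊕ Fin b := fun v => if v = c then .inl 2 else .inr (e v)
  have hψ (v : V) (hv : v ≠ c) : (broom b).Adj (ψ c) (ψ v) := by
    simp only [ψ, if_neg hv, if_true]
    exact (fromEdgeSet_adj _).2 ⟨.inr ⟨e v, rfl⟩, by simp⟩
  refine ⟨b, ⟨⟨⟨ψ, fun {u v} huv => ?_⟩, fun u v huv => ?_⟩⟩⟩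
  · obtain ⟨hne, rfl | rfl⟩ := starGraph_adj.1 huv
    · exact hψ v hne.symm
    · exact (hψ u hne).symm
  · simp only [RelHom.coeFn_mk, ψ] at huv
    split_ifs at huv <;> simp_all

/-- If the edges of `G` can be oriented with out-degrees at most one, then suitable list colourings
show that `G` is `r`-list-Ramsey for exceptional families only. -/
theorem IsFunctional.not_listRamsey {ι : Type*} {W : ι → Type*} {F : ∀ i, SimpleGraph (W i)}
    {r : ℕ} (hr : 2 ≤ r) (hex : ¬ ListRamseyExceptional F r) {V : Type*} [Finite V]
    {G : SimpleGraph V} {f : V → V} (hG : G.IsFunctional f) : ¬ ListRamsey F r G := by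
  rintro ⟨L, hL, h⟩
  obtain ⟨L', hL', hχ⟩ := hG.exists_edgeLabeling L hL
  rw [ListRamseyExceptional, not_or] at hex
  have conn {i : ι} (C : (F i).ConnectedComponent) : C.toSimpleGraph.Connected :=
    C.connected_toSimpleGraph
  rcases hr.eq_or_lt with rfl | hr3
  · by_cases hB : ∃ i, (F i).IsBGraph
    · have hC : ¬ ∃ i, (F i).IsCStarGraph := fun hC => hex.2 ⟨rfl, hB, hC⟩
      obtain ⟨χ, h1, h2⟩ := exists_listColoring_conflicts_odd f L' hL'
      obtain ⟨κ, hκ, hadj⟩ := hχ χ h1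
      obtain ⟨i, a, ⟨φ⟩⟩ := h κ hκ
      refine hC ⟨i, fun C => ?_⟩
      induction C using ConnectedComponent.ind with | _ x₀
      rcases exists_star_or_conflict (hadj a) (φ x₀) with
        ⟨T, hxT, hT, c, hc⟩ | ⟨w, hw, hfw, hx⟩
      · exact .inr ((conn _).isStar_of_isContained
          ((ConnectedComponent.isContained_induce_of_closed φ T hT x₀ hxT).trans hc))
      · have hcyc : ∀ w ∈ {v | χ v = a ∧ f v ≠ v}, f w ∈ {v | χ v = a ∧ f v ≠ v} →
            Odd (Function.minimalPeriod f w) ∧ ∀ k, f^[k] w ∈ {v | χ v = a ∧ f v ≠ v} := by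
          rintro w ⟨hw, hne⟩ ⟨hfw, -⟩
          obtain ⟨hodd, hconst⟩ := h2 w hne (hw.trans hfw.symm)
          refine ⟨hodd, fun k => ⟨(hconst k).trans hw, fun hfix => hne ?_⟩⟩
          have hper : w ∈ Function.periodicPts f :=
            Function.minimalPeriod_pos_iff_mem_periodicPts.1 hodd.pos
          rw [← Function.IsFixedPt, ← Function.minimalPeriod_eq_one_iff_isFixedPt,
            Function.minimalPeriod_apply_iterate hper] at hfix
          exact Function.minimalPeriod_eq_one_iff_isFixedPt.1 hfix
        obtain ⟨T, hxT, hT, l, hl, hc⟩ := exists_oddCycle_of_conflict (fun v hv => hv.2)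
          (hadj a) hcyc w hw hfw (φ x₀) hx
        exact .inl ⟨l, hl,
          (ConnectedComponent.isContained_induce_of_closed φ T hT x₀ hxT).trans hc⟩
    · obtain ⟨χ, h1, h2⟩ := exists_listColoring_conflicts_separated f L' fun v => (hL' v).ge
      obtain ⟨κ, hκ, hadj⟩ := hχ χ h1
      obtain ⟨i, a, ⟨φ⟩⟩ := h κ hκ
      refine hB ⟨i, fun C => ?_⟩
      induction C using ConnectedComponent.ind with | _ x₀
      rcases exists_star_or_conflict (hadj a) (φ x₀) with
        ⟨T, hxT, hT, c, hc⟩ | ⟨w, hw, hfw, hx⟩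
      · obtain ⟨b, hb⟩ := starGraph_isContained_broom c
        exact ⟨b, ((ConnectedComponent.isContained_induce_of_closed φ T hT x₀ hxT).trans
          hc).trans hb⟩
      · obtain ⟨T, hxT, hT, b, hb⟩ := exists_broom_of_conflict (fun _ => hG.eq_of_apply_apply)
          (fun v hv => hv.2) (hadj a)
          (fun y hy hfy w hw hfw => h2 y w hy.2 (hy.1.trans hfy.1.symm) hw.2
            (hw.1.trans hfw.1.symm)) w hw hfw (φ x₀) hx
        exact ⟨b, (ConnectedComponent.isContained_induce_of_closed φ T hT x₀ hxT).trans hb⟩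
  · obtain ⟨χ, h1, h2⟩ := exists_listColoring_of_three_le f L' fun v => by rw [hL' v]; exact hr3
    obtain ⟨κ, hκ, hadj⟩ := hχ χ h1
    obtain ⟨i, a, ⟨φ⟩⟩ := h κ hκ
    refine hex.1 ⟨i, fun C => ?_⟩
    induction C using ConnectedComponent.ind with | _ x₀
    rcases exists_star_or_conflict (hadj a) (φ x₀) with ⟨T, hxT, hT, c, hc⟩ | ⟨w, hw, hfw, hx⟩
    · exact (conn _).isStar_of_isContained
        ((ConnectedComponent.isContained_induce_of_closed φ T hT x₀ hxT).trans hc)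
    · exact absurd (hw.1.trans hfw.1.symm) (h2 w hw.2)

open MeasureTheory in
theorem tendsto_probListRamsey_of_not_exceptional {ι : Type*} {W : ι → Type*}
    {F : ∀ i, SimpleGraph (W i)} {r : ℕ} (hr : 2 ≤ r) (hex : ¬ ListRamseyExceptional F r)
    (p : ℕ → unitInterval) (hp : ∀ᶠ n : ℕ in atTop, (p n : ℝ) ≤ (1 / 40) / (n : ℝ)) :
    Tendsto (fun n : ℕ => probListRamsey F r n (p n)) atTop (𝓝 0) := by
  refine tendsto_of_tendsto_of_tendsto_of_le_of_le' tendsto_const_nhds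
    tendsto_one_div_atTop_nhds_zero_nat (.of_forall fun n => measureReal_nonneg) ?_
  filter_upwards [hp, eventually_gt_atTop 0] with n hn hn0
  refine le_trans (measureReal_mono ?_) (binomialRandom_not_isFunctional_le n hn0 (p n) hn)
  rintro G hG ⟨f, hf⟩
  exact hf.not_listRamsey hr hex hG

end SimpleGraph

/-! ### List-Ramsey graphs as disjoint unions -/

namespace SimpleGraph

/-- List-Ramsey graphs are closed under taking supergraphs: edges outside the subgraph get an
arbitrary list. -/
theorem ListRamsey.of_isContained {ι : Type*} {W : ι → Type*} {F : ∀ i, SimpleGraph (W i)} {r : ℕ}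
    {V V' : Type*} {G : SimpleGraph V} {G' : SimpleGraph V'} (h : ListRamsey F r G)
    (hGG' : G.IsContained G') : ListRamsey F r G' := by
  classical
  obtain ⟨φ⟩ := hGG'
  obtain ⟨L, hL, h⟩ := h
  refine ⟨fun e' => if h : ∃ e, φ.mapEdgeSet e = e' then L h.choose else Finset.range r,
    fun e' => ?_, fun χ hχ => ?_⟩
  · dsimp only
    split_ifs with h
    · exact hL _
    · exact Finset.card_range r
  · obtain ⟨i, a, hF⟩ := h (fun e => χ (φ.mapEdgeSet e)) (fun e => by
      have h1 := hχ (φ.mapEdgeSet e)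
      have h2 : ∃ e₀, φ.mapEdgeSet e₀ = φ.mapEdgeSet e := ⟨e, rfl⟩
      dsimp only at h1
      rw [dif_pos h2] at h1
      rwa [φ.mapEdgeSet.injective h2.choose_spec] at h1)
    refine ⟨i, a, hF.trans ⟨⟨⟨φ, fun {x y} hxy => ?_⟩, φ.injective⟩⟩⟩
    obtain ⟨hadj, hc⟩ := (EdgeLabeling.labelGraph_adj x y).1 hxy
    exact (EdgeLabeling.labelGraph_adj _ _).2 ⟨φ.toHom.map_adj hadj, hc⟩

/-- The graph with the edges `v — f v`. -/
def functionalGraph {V : Type*} (f : V → V) : SimpleGraph V :=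
  fromRel fun x y => f x = y

theorem functionalGraph_adj_apply {V : Type*} {f : V → V} {v : V} (h : f v ≠ v) :
    (functionalGraph f).Adj v (f v) :=
  (fromRel_adj _ _ _).2 ⟨h.symm, .inl rfl⟩

theorem functionalGraph_isContained {V V' : Type*} {f : V → V} {G : SimpleGraph V'} (φ : V ↪ V')
    (h : ∀ v, G.Adj (φ v) (φ (f v))) : (functionalGraph f).IsContained G := by
  refine ⟨⟨⟨φ, fun {x y} hxy => ?_⟩, φ.injective⟩⟩
  rcases ((fromRel_adj _ _ _).1 hxy).2 with rfl | rfl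
  · exact h x
  · exact (h y).symm

/-- For a disjoint union of functional graphs with a list for each of them, an edge colouring
amounts to a colour `κ v` for the edge `v — f v`, for every `v`. -/
theorem listRamsey_functionalGraph_sigma {ι : Type*} {W : ι → Type*} {F : ∀ i, SimpleGraph (W i)}
    {r : ℕ} {Q : Type*} {U : Q → Type*} (g : ∀ q, U q → U q) (hg : ∀ q x, g q x ≠ x)
    (S : Q → Finset ℕ) (hS : ∀ q, (S q).card = r)
    (h : ∀ (H : ℕ → SimpleGraph (Σ q, U q)) (κ : (Σ q, U q) → ℕ), (∀ v, κ v ∈ S v.1) →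
      (∀ v, (H (κ v)).Adj v ⟨v.1, g v.1 v.2⟩) → ∃ i c, (F i).IsContained (H c)) :
    ListRamsey F r (functionalGraph fun v : Σ q, U q => ⟨v.1, g v.1 v.2⟩) := by
  have hne (v : Σ q, U q) : (⟨v.1, g v.1 v.2⟩ : Σ q, U q) ≠ v := by
    obtain ⟨q, x⟩ := v
    intro hv
    exact hg q x (eq_of_heq (Sigma.mk.inj_iff.1 hv).2)
  have hadj (v : Σ q, U q) : (functionalGraph fun v : Σ q, U q => ⟨v.1, g v.1 v.2⟩).Adj v
      ⟨v.1, g v.1 v.2⟩ :=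
    functionalGraph_adj_apply (f := fun v : Σ q, U q => ⟨v.1, g v.1 v.2⟩) (hne v)
  refine ⟨fun e => S (Quot.out e.1).1.1, fun e => hS _, fun χ hχ => ?_⟩
  refine h χ.labelGraph (fun v => χ ⟨s(v, ⟨v.1, g v.1 v.2⟩), hadj v⟩)
    (fun v => ?_) (fun v => ?_)
  · have h1 := hχ ⟨s(v, ⟨v.1, g v.1 v.2⟩), hadj v⟩
    have h2 : (Quot.out s(v, (⟨v.1, g v.1 v.2⟩ : Σ q, U q))).1.1 = v.1 := by
      have h3 := Sym2.out_fst_mem s(v, (⟨v.1, g v.1 v.2⟩ : Σ q, U q))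
      rcases Sym2.mem_iff.1 h3 with h3 | h3 <;> rw [h3]
    dsimp only at h1
    rwa [h2] at h1
  · exact (EdgeLabeling.labelGraph_adj _ _).2 ⟨hadj v, rfl⟩

/-- The restriction of a graph on a disjoint union to one of the parts. -/
abbrev sigmaPart {Q : Type*} {U : Q → Type*} (H : SimpleGraph (Σ q, U q)) (q : Q) :
    SimpleGraph (U q) :=
  H.comap (Sigma.mk q)

/-- A graph embeds into a disjoint union if its components embed into distinct parts. -/
theorem isContained_of_forall_component {W : Type*} {F : SimpleGraph W} {Q : Type*}
    {U : Q → Type*} {H : SimpleGraph (Σ q, U q)} (σ : F.ConnectedComponent → Q)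
    (hσ : Function.Injective σ)
    (h : ∀ C : F.ConnectedComponent, C.toSimpleGraph.IsContained (H.sigmaPart (σ C))) :
    F.IsContained H := by
  have h' (C : F.ConnectedComponent) : ∃ ψ : C.toSimpleGraph.Copy H, ∀ x, (ψ x).1 = σ C := by
    obtain ⟨ψ⟩ := h C
    exact ⟨⟨⟨fun x => ⟨σ C, ψ x⟩, fun {x y} hxy => ψ.toHom.map_adj hxy⟩, fun x y hxy =>
      ψ.injective (eq_of_heq (Sigma.mk.inj_iff.1 hxy).2)⟩, fun x => rfl⟩
  choose ψ hψ using h'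
  let Φ : W → Σ q, U q := fun v => ψ (F.connectedComponentMk v) ⟨v, rfl⟩
  have hΦ (C : F.ConnectedComponent) (v : W) (hv : v ∈ C.supp) : Φ v = ψ C ⟨v, hv⟩ := by
    have : F.connectedComponentMk v = C := hv
    subst this
    rfl
  refine ⟨⟨⟨Φ, fun {x y} hxy => ?_⟩, fun x y hxy => ?_⟩⟩
  · have hy : y ∈ (F.connectedComponentMk x).supp :=
      (ConnectedComponent.connectedComponentMk_eq_of_adj hxy).symm
    rw [hΦ (F.connectedComponentMk x) x rfl, hΦ _ y hy]
    exact (ψ _).toHom.map_adj hxy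
  · have h1 : F.connectedComponentMk y = F.connectedComponentMk x := by
      apply hσ
      rw [← hψ _ ⟨x, rfl⟩, ← hψ _ ⟨y, rfl⟩]
      exact congrArg Sigma.fst (show Φ x = Φ y from hxy).symm
    have hxy' : Φ x = Φ y := hxy
    rw [hΦ (F.connectedComponentMk x) x rfl, hΦ _ y h1] at hxy'
    exact congrArg Subtype.val ((ψ _).injective hxy')

theorem isContained_of_card_le {W : Type*} [Finite W] {F : SimpleGraph W} {Q : Type*}
    {U : Q → Type*} {H : SimpleGraph (Σ q, U q)} (s : Finset Q)
    (hs : Nat.card F.ConnectedComponent ≤ s.card)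
    (h : ∀ q ∈ s, ∀ C : F.ConnectedComponent, C.toSimpleGraph.IsContained (H.sigmaPart q)) :
    F.IsContained H := by
  classical
  have := Fintype.ofFinite F.ConnectedComponent
  obtain ⟨σ⟩ : Nonempty (F.ConnectedComponent ↪ s) :=
    Function.Embedding.nonempty_of_card_le (by simpa [Nat.card_eq_fintype_card] using hs)
  exact isContained_of_forall_component (fun C => (σ C).1)
    (Subtype.val_injective.comp σ.injective) fun C => h _ (σ C).2 C

theorem broom_mono {b b' : ℕ} (h : b ≤ b') : (broom b).IsContained (broom b') := by
  let ψ : Fin 3 ⊕ Fin b → Fin 3 ⊕ Fin b' := Sum.map id (Fin.castLE h)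
  have hψ : Function.Injective ψ :=
    Function.injective_id.sumMap (Fin.castLE_injective h)
  refine ⟨⟨⟨ψ, fun {x y} hxy => ?_⟩, hψ⟩⟩
  obtain ⟨h1, h2⟩ := (fromEdgeSet_adj _).1 hxy
  refine (fromEdgeSet_adj _).2 ⟨?_, hψ.ne h2⟩
  have : ∀ e, e ∈ ({s(Sum.inl 0, Sum.inl 1), s(Sum.inl 1, Sum.inl 2)} ∪
      Set.range fun h : Fin b => s(Sum.inl 2, Sum.inr h) : Set (Sym2 (Fin 3 ⊕ Fin b))) →
      e.map ψ ∈ ({s(Sum.inl 0, Sum.inl 1), s(Sum.inl 1, Sum.inl 2)} ∪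
      Set.range fun h : Fin b' => s(Sum.inl 2, Sum.inr h) : Set (Sym2 (Fin 3 ⊕ Fin b'))) := by
    rintro e ((rfl | rfl) | ⟨h, rfl⟩)
    · exact .inl (.inl rfl)
    · exact .inl (.inr rfl)
    · exact .inr ⟨_, rfl⟩
  exact this _ h1

theorem broom_isContained {U : Type*} {H : SimpleGraph U} {b : ℕ} (x₀ x₁ x₂ : U) (y : Fin b ↪ U)
    (h01 : H.Adj x₀ x₁) (h12 : H.Adj x₁ x₂) (h02 : x₀ ≠ x₂) (hy : ∀ h, H.Adj x₂ (y h))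
    (hy0 : ∀ h, y h ≠ x₀) (hy1 : ∀ h, y h ≠ x₁) : (broom b).IsContained H := by
  let ψ : Fin 3 ⊕ Fin b → U := Sum.elim ![x₀, x₁, x₂] y
  have hψ : Function.Injective ψ := by
    refine Function.Injective.sumElim ?_ y.injective ?_
    · intro i j hij
      have := h01.ne
      have := h12.ne
      fin_cases i <;> fin_cases j <;> simp_all
    · intro i h
      have := (hy h).ne
      fin_cases i <;> simp [*, Ne.symm (hy0 h), Ne.symm (hy1 h)]
  refine ⟨⟨⟨ψ, fun {u v} huv => ?_⟩, hψ⟩⟩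
  have : ∀ e, e ∈ ({s(Sum.inl 0, Sum.inl 1), s(Sum.inl 1, Sum.inl 2)} ∪
      Set.range fun h : Fin b => s(Sum.inl 2, Sum.inr h) : Set (Sym2 (Fin 3 ⊕ Fin b))) →
      e.map ψ ∈ H.edgeSet := by
    rintro e ((rfl | rfl) | ⟨h, rfl⟩)
    · exact h01
    · exact h12
    · exact hy h
  exact this _ ((fromEdgeSet_adj _).1 huv).1

theorem IsStar.isContained {W U : Type*} [Finite W] {K : SimpleGraph W} (hK : K.IsStar)
    {H : SimpleGraph U} {b : ℕ} (hb : Nat.card W ≤ b) (x : U) (y : Fin b ↪ U)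
    (hy : ∀ h, H.Adj x (y h)) : K.IsContained H := by
  classical
  obtain ⟨c, rfl⟩ := hK
  have := Fintype.ofFinite W
  obtain ⟨e⟩ : Nonempty (W ↪ Fin b) :=
    Function.Embedding.nonempty_of_card_le (by simpa [Nat.card_eq_fintype_card] using hb)
  let ψ : W → U := fun w => if w = c then x else y (e w)
  have hψ (w : W) (hw : w ≠ c) : H.Adj (ψ c) (ψ w) := by
    simp only [ψ, if_neg hw, if_true]
    exact hy _
  refine ⟨⟨⟨ψ, fun {u v} huv => ?_⟩, fun u v huv => ?_⟩⟩
  · obtain ⟨hne, rfl | rfl⟩ := starGraph_adj.1 huv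
    · exact hψ v hne.symm
    · exact (hψ u hne).symm
  · by_contra hne
    by_cases hu : u = c
    · subst hu
      exact (hψ v (Ne.symm hne)).ne huv
    · by_cases hv : v = c
      · subst hv
        exact (hψ u hne).ne huv.symm
      · simp only [RelHom.coeFn_mk, ψ, if_neg hu, if_neg hv] at huv
        exact hne (e.injective (y.injective huv))

end SimpleGraph

/-! ### Odd cycles with hairs -/

theorem ZMod.one_ne_zero_of_one_le {l : ℕ} (hl : 1 ≤ l) : (1 : ZMod (2 * l + 1)) ≠ 0 := by
  have : Fact (1 < 2 * l + 1) := ⟨by omega⟩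
  exact one_ne_zero

theorem ZMod.two_ne_zero_of_one_le {l : ℕ} (hl : 1 ≤ l) : (1 + 1 : ZMod (2 * l + 1)) ≠ 0 := by
  intro h
  have h2 : ((2 : ℕ) : ZMod (2 * l + 1)) = 0 := by push_cast; rw [← h]; norm_num
  have := Nat.le_of_dvd (by norm_num) ((ZMod.natCast_eq_zero_iff _ _).1 h2)
  omega

/-- Two colours cannot alternate around an odd cycle. -/
theorem ZMod.not_forall_alternate {l : ℕ} (s : ZMod (2 * l + 1) → ℕ) {a b : ℕ}
    (hs : ∀ i, s i = a ∨ s i = b) : ¬ ∀ i, s (i + 1) ≠ s i := by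
  intro h
  have key (k : ℕ) : s k = s 0 ↔ Even k := by
    induction k with
    | zero => simp
    | succ k ih =>
      have h1 := h k
      have h2 := hs k
      have h3 := hs (k + 1)
      have h4 := hs 0
      rw [Nat.even_add_one, ← ih]
      push_cast
      omega
  have h1 := (key (2 * l + 1)).1 (by rw [ZMod.natCast_self])
  exact (Nat.not_even_iff_odd.2 ⟨l, rfl⟩) h1

/-- Induction around a cycle, in either direction. -/
theorem ZMod.forall_of_step {n : ℕ} [NeZero n] (P : ZMod n → Prop) (ε : ZMod n)
    (hε : ε = 1 ∨ ε = -1) (h : ∀ i, P i → P (i + ε)) (j : ZMod n) (hj : P j) (i : ZMod n) :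
    P i := by
  have key (k : ℕ) : P (j + k * ε) := by
    induction k with
    | zero => simpa using hj
    | succ k ih =>
      have := h _ ih
      rwa [show j + k * ε + ε = j + ((k + 1 : ℕ) : ZMod n) * ε by push_cast; ring] at this
  obtain ⟨k, hk⟩ := ZMod.natCast_zmod_surjective ((i - j) * ε)
  have := key k
  rw [hk] at this
  have hεε : ε * ε = 1 := by rcases hε with rfl | rfl <;> ring
  rwa [mul_assoc, hεε, mul_one, add_sub_cancel] at this

namespace SimpleGraph

/-- The self-map whose functional graph is a cycle of length `2 l + 1` with `D` hairs attached to
each of its vertices: `(i, none)` is the vertex `i` of the cycle and `(i, some h)` is a hair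
at `i`. -/
def hairyCycleMap (l D : ℕ) : ZMod (2 * l + 1) × Option (Fin D) → ZMod (2 * l + 1) × Option (Fin D)
  | (i, none) => (i + 1, none)
  | (i, some _) => (i, none)

theorem hairyCycleMap_ne {l D : ℕ} (hl : 1 ≤ l) (x : ZMod (2 * l + 1) × Option (Fin D)) :
    hairyCycleMap l D x ≠ x := by
  obtain ⟨i, _ | h⟩ := x
  · simpa [hairyCycleMap] using ZMod.one_ne_zero_of_one_le hl
  · simp [hairyCycleMap]

theorem hairyCycleMap_hairyCycleMap_ne {l D : ℕ} (hl : 1 ≤ l)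
    (x : ZMod (2 * l + 1) × Option (Fin D)) : hairyCycleMap l D (hairyCycleMap l D x) ≠ x := by
  obtain ⟨i, _ | h⟩ := x
  · simpa [hairyCycleMap, add_assoc] using ZMod.two_ne_zero_of_one_le hl
  · simp [hairyCycleMap]

theorem cycleGraph_isContained {U : Type*} {H : SimpleGraph U} {l : ℕ}
    (ψ : ZMod (2 * l + 1) ↪ U) (h : ∀ i, H.Adj (ψ i) (ψ (i + 1))) :
    (cycleGraph (2 * l + 1)).IsContained H := by
  have hsub {u v : Fin (2 * l + 1)} (huv : (u - v).val = 1) :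
      ((u.val : ℕ) : ZMod (2 * l + 1)) = (v.val : ℕ) + 1 := by
    rw [Fin.val_sub] at huv
    have h1 := congrArg (Nat.cast : ℕ → ZMod (2 * l + 1)) huv
    rw [ZMod.natCast_mod, Nat.cast_add, Nat.cast_sub v.2.le, ZMod.natCast_self] at h1
    push_cast at h1
    linear_combination h1
  refine ⟨⟨⟨fun u => ψ (u.val : ℕ), fun {u v} huv => ?_⟩, fun u v huv => ?_⟩⟩
  · rcases cycleGraph_adj'.1 huv with huv | huv
    · simp only [hsub huv]
      exact (h _).symm
    · simp only [hsub huv]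
      exact h _
  · have h1 : ((u.val : ℕ) : ZMod (2 * l + 1)) = (v.val : ℕ) := ψ.injective huv
    rw [ZMod.natCast_eq_natCast_iff', Nat.mod_eq_of_lt u.2, Nat.mod_eq_of_lt v.2] at h1
    exact Fin.ext h1

/-- Among the hairs at a vertex, many have the same colour. -/
theorem exists_monochromatic_hairs {l D β : ℕ} (κ : ZMod (2 * l + 1) × Option (Fin D) → ℕ)
    (S : Finset ℕ) (hS : S.Nonempty) (hκ : ∀ x, κ x ∈ S) (hD : S.card * β ≤ D)
    (i : ZMod (2 * l + 1)) :
    ∃ c ∈ S, ∃ y : Fin β ↪ Fin D, ∀ h, κ (i, some (y h)) = c := by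
  classical
  obtain ⟨c, hc, hcard⟩ := Finset.exists_le_card_fiber_of_mul_le_card_of_maps_to
    (s := (Finset.univ : Finset (Fin D))) (t := S) (f := fun h => κ (i, some h))
    (fun h _ => hκ _) hS (by simpa using hD)
  obtain ⟨y⟩ : Nonempty (Fin β ↪ (Finset.univ.filter fun h : Fin D => κ (i, some h) = c)) :=
    Function.Embedding.nonempty_of_card_le (by
      rwa [Fintype.card_coe, Fintype.card_fin])
  exact ⟨c, hc, y.trans (Function.Embedding.subtype _),
    fun h => (Finset.mem_filter.1 (y h).2).2⟩

/-- If an odd cycle with many hairs is coloured with two colours, then there is a monochromatic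
broom with many hairs, or the cycle is monochromatic. -/
theorem exists_broom_or_cycle {l D β : ℕ} (hl : 1 ≤ l) (hβ : 1 ≤ β) (hD : 2 * β ≤ D)
    {a b : ℕ} (hab : a ≠ b) (H : ℕ → SimpleGraph (ZMod (2 * l + 1) × Option (Fin D)))
    (κ : ZMod (2 * l + 1) × Option (Fin D) → ℕ) (hκ : ∀ x, κ x ∈ ({a, b} : Finset ℕ))
    (hH : ∀ x, (H (κ x)).Adj x (hairyCycleMap l D x)) :
    ∃ c ∈ ({a, b} : Finset ℕ), (broom β).IsContained (H c) ∨
      (cycleGraph (2 * l + 1)).IsContained (H c) := by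
  classical
  by_contra hcon
  choose m hm y hy using fun i => exists_monochromatic_hairs κ {a, b} ⟨a, by simp⟩ hκ
    (by rwa [Finset.card_pair hab]) i
  -- `c i` is the colour of the cycle edge leaving from `i`, `m i` is a frequent colour at `i`
  let c : ZMod (2 * l + 1) → ℕ := fun i => κ (i, none)
  have hc (i) : c i = a ∨ c i = b := by simpa using hκ (i, none)
  have hm' (i) : m i = a ∨ m i = b := by simpa using hm i
  have hcyc (i) : (H (c i)).Adj (i, none) (i + 1, none) := hH (i, none)
  have hhair (i) (h : Fin β) : (H (m i)).Adj (i, some (y i h)) (i, none) := by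
    have := hH (i, some (y i h))
    rwa [hy] at this
  have hbr (i) (x₀ x₁ : ZMod (2 * l + 1) × Option (Fin D)) (h01 : (H (m i)).Adj x₀ x₁)
      (h12 : (H (m i)).Adj x₁ (i, none)) (h0 : x₀.1 ≠ i) (h1 : x₁.1 ≠ i) : False := by
    refine hcon ⟨m i, hm i, .inl (broom_isContained x₀ x₁ (i, none)
      ⟨fun h => (i, some (y i h)), fun h h' hh => (y i).injective (by simpa using hh)⟩ h01 h12
      (fun h => h0 (congrArg Prod.fst h)) (fun h => (hhair i h).symm)
      (fun h hh => h0 (congrArg Prod.fst hh).symm) (fun h hh => h1 (congrArg Prod.fst hh).symm))⟩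
  have one_ne := ZMod.one_ne_zero_of_one_le hl
  have two_ne := ZMod.two_ne_zero_of_one_le hl
  have ne1 (i : ZMod (2 * l + 1)) : i + 1 ≠ i := fun h => one_ne (by simpa using h)
  have ne2 (i : ZMod (2 * l + 1)) : i + 1 + 1 ≠ i := fun h =>
    two_ne (by simpa [add_assoc] using h)
  -- the path of the broom starts with a hair at `i`
  have R1 (i) (h1 : m i = c i) (h2 : m (i + 1) = c i) : False := by
    refine hbr (i + 1) (i, some (y i ⟨0, hβ⟩)) (i, none) ?_ ?_ (ne1 i).symm (ne1 i).symm
    · rw [h2, ← h1]; exact hhair i _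
    · rw [h2]; exact hcyc i
  -- the path of the broom consists of two cycle edges, traversed backwards or forwards
  have R2 (i) (h1 : c (i + 1) = c i) : m i ≠ c i := by
    intro h2
    refine hbr i (i + 1 + 1, none) (i + 1, none) ?_ ?_ (ne2 i) (ne1 i)
    · rw [h2, ← h1]; exact (hcyc (i + 1)).symm
    · rw [h2]; exact (hcyc i).symm
  have R3 (i) (h1 : c (i + 1) = c i) : m (i + 1 + 1) ≠ c i := by
    intro h2
    refine hbr (i + 1 + 1) (i, none) (i + 1, none) ?_ ?_ (ne2 i).symm (ne1 (i + 1)).symm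
    · rw [h2]; exact hcyc i
    · rw [h2, ← h1]; exact hcyc (i + 1)
  -- if a frequent colour agrees with an adjacent cycle edge, then this propagates around the cycle
  -- and forces the cycle edges to alternate
  have hout (j) : m j ≠ c j := by
    intro hj
    have hstep (i) (hi : m i = c i) : c (i + 1) ≠ c i ∧ m (i + 1) = c (i + 1) := by
      have h1 : c (i + 1) ≠ c i := fun h => R2 i h hi
      have h2 : m (i + 1) ≠ c i := fun h => R1 i hi h
      refine ⟨h1, ?_⟩
      have := hc i; have := hc (i + 1); have := hm' (i + 1)
      omega
    have hall := ZMod.forall_of_step (fun i => m i = c i) 1 (.inl rfl)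
      (fun i hi => (hstep i hi).2) j hj
    exact ZMod.not_forall_alternate c hc fun i => (hstep i (hall i)).1
  have hin (j) : m (j + 1) ≠ c j := by
    intro hj
    have hstep (i) (hi : m (i + 1) = c i) :
        c (i + -1 + 1) ≠ c (i + -1) ∧ m (i + -1 + 1) = c (i + -1) := by
      have e : i + -1 + 1 = i := by ring
      have h1 : c (i + -1 + 1) ≠ c (i + -1) := by
        intro h
        refine R3 (i + -1) h ?_
        rw [← h, e, hi]
      refine ⟨h1, ?_⟩
      rw [e] at h1 ⊢
      have := hout i
      have := hc i; have := hc (i + -1); have := hm' i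
      omega
    have hall := ZMod.forall_of_step (fun i => m (i + 1) = c i) (-1) (.inr rfl)
      (fun i hi => (hstep i hi).2) j hj
    refine ZMod.not_forall_alternate c hc fun i => ?_
    have := (hstep (i + 1) (hall _)).1
    rwa [show i + 1 + -1 = i by ring] at this
  have hconst (i) : c (i + 1) = c i := by
    have := hout (i + 1); have := hin i
    have := hc i; have := hc (i + 1); have := hm' (i + 1)
    omega
  have hall := ZMod.forall_of_step (fun i => c i = c 0) 1 (.inl rfl)
    (fun i hi => (hconst i).trans hi) 0 rfl
  refine hcon ⟨c 0, hκ _, .inr (cycleGraph_isContained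
    ⟨fun i => (i, none), fun i j hij => congrArg Prod.fst hij⟩ fun i => ?_)⟩
  rw [← hall i]
  exact hcyc i

/-- A hairy cycle contains a large monochromatic star. -/
theorem exists_star_of_hairs {l D β : ℕ} (H : ℕ → SimpleGraph (ZMod (2 * l + 1) × Option (Fin D)))
    (κ : ZMod (2 * l + 1) × Option (Fin D) → ℕ) (S : Finset ℕ) (hS : S.Nonempty)
    (hκ : ∀ x, κ x ∈ S) (hD : S.card * β ≤ D)
    (hH : ∀ x, (H (κ x)).Adj x (hairyCycleMap l D x)) :
    ∃ c ∈ S, ∀ (W : Type*) [Finite W] (K : SimpleGraph W), K.IsStar → Nat.card W ≤ β →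
      K.IsContained (H c) := by
  obtain ⟨c, hc, y, hy⟩ := exists_monochromatic_hairs κ S hS hκ hD 0
  refine ⟨c, hc, fun W _ K hK hW => hK.isContained hW (0, none)
    ⟨fun h => (0, some (y h)), fun h h' hh => y.injective (by simpa using hh)⟩ fun h => ?_⟩
  have := hH (0, some (y h))
  rw [hy] at this
  exact this.symm

end SimpleGraph

/-! ### Exceptional families -/

namespace SimpleGraph

open MeasureTheory in
/-- If some disjoint union of hairy odd cycles is list-Ramsey, then so is `G(n, p)` with
probability bounded away from zero. -/
theorem exists_pos_le_probListRamsey {ι : Type*} {W : ι → Type*} {F : ∀ i, SimpleGraph (W i)}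
    {r : ℕ} {Q : Type*} [Finite Q] (l : Q → ℕ) (hl : ∀ q, 1 ≤ l q) (D : ℕ)
    (h : ListRamsey F r (functionalGraph
      fun v : Σ q, ZMod (2 * l q + 1) × Option (Fin D) => ⟨v.1, hairyCycleMap (l v.1) D v.2⟩))
    (p : ℕ → unitInterval) (c : ℝ) (hc : 0 < c)
    (hp : ∀ᶠ n : ℕ in atTop, c / (n : ℝ) ≤ (p n : ℝ)) :
    ∃ δ : ℝ, 0 < δ ∧ ∀ᶠ n : ℕ in atTop, δ ≤ probListRamsey F r n (p n) := by
  have := Fintype.ofFinite Q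
  obtain ⟨δ, hδ, hev⟩ := exists_pos_le_binomialRandom_copy
    (fun v : Σ q, ZMod (2 * l q + 1) × Option (Fin D) => ⟨v.1, hairyCycleMap (l v.1) D v.2⟩)
    (fun v hv => hairyCycleMap_ne (hl v.1) v.2 (eq_of_heq (Sigma.mk.inj_iff.1 hv).2))
    (fun v hv => hairyCycleMap_hairyCycleMap_ne (hl v.1) v.2
      (eq_of_heq (Sigma.mk.inj_iff.1 hv).2)) p c hc hp
  refine ⟨δ, hδ, hev.mono fun n hn => hn.trans (measureReal_mono ?_)⟩
  rintro G ⟨φ, hφ⟩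
  exact h.of_isContained (functionalGraph_isContained φ hφ)

/-- For a star forest with `t` components, take `r t` hairy triangles, all with the same list:
each contains a large monochromatic star, and `t` of these stars have the same colour. -/
theorem exists_listRamsey_of_isStarForest {ι : Type*} {W : ι → Type*} [∀ i, Finite (W i)]
    {F : ∀ i, SimpleGraph (W i)} {r : ℕ} (hr : 2 ≤ r) {i : ι} (hi : (F i).IsStarForest) :
    ∃ N D : ℕ, ListRamsey F r (functionalGraph
      fun v : Σ _ : Fin N, ZMod (2 * 1 + 1) × Option (Fin D) =>
        ⟨v.1, hairyCycleMap 1 D v.2⟩) := by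
  classical
  have hne : (Finset.range r).Nonempty := ⟨0, Finset.mem_range.2 (by omega)⟩
  refine ⟨r * Nat.card (F i).ConnectedComponent, r * Nat.card (W i),
    listRamsey_functionalGraph_sigma (fun _ => hairyCycleMap 1 _)
      (fun _ => hairyCycleMap_ne le_rfl) (fun _ => Finset.range r)
      (fun _ => Finset.card_range r) fun H κ hκ hH => ⟨i, ?_⟩⟩
  choose c hc hstar using fun q => exists_star_of_hairs (β := Nat.card (W i))
    (fun c => (H c).sigmaPart q) (fun x => κ ⟨q, x⟩) (Finset.range r) hne
    (fun x => hκ ⟨q, x⟩) (by rw [Finset.card_range]) (fun x => hH ⟨q, x⟩)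
  obtain ⟨a, -, ha⟩ := Finset.exists_le_card_fiber_of_mul_le_card_of_maps_to
    (s := Finset.univ) (t := Finset.range r) (f := c)
    (n := Nat.card (F i).ConnectedComponent) (fun q _ => hc q) hne (by simp)
  refine ⟨a, isContained_of_card_le _ ha fun q hq C => ?_⟩
  rw [← (Finset.mem_filter.1 hq).2]
  exact hstar q _ C.toSimpleGraph (hi C)
    (Nat.card_le_card_of_injective _ Subtype.val_injective)

theorem IsBGraph.exists_broom {W : Type*} [Finite W] {B : SimpleGraph W} (hB : B.IsBGraph) :
    ∃ b₀, ∀ b, b₀ ≤ b → ∀ C : B.ConnectedComponent, C.toSimpleGraph.IsContained (broom b) := by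
  choose b hb using hB
  obtain ⟨b₀, hb₀⟩ := Finite.exists_le b
  exact ⟨b₀, fun b' hb' C => (hb C).trans (broom_mono ((hb₀ C).trans hb'))⟩

/-- For two colours, a `𝓑`-graph `B` and a `𝓒*`-graph `C`, take for every component `K` of `C` and
every pair of colours from a palette with more colours than `C` has components many hairy odd
cycles, of the length prescribed by `K`, with that pair as constant list. If no colour contains `B`,
then among any two colours of the palette one contains `K`, so for each `K` at most one colour is
lost. Hence some colour contains all of `C`. -/
theorem exists_listRamsey_of_isBGraph_of_isCStarGraph {ι : Type*} {W : ι → Type*}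
    [∀ i, Finite (W i)] {F : ∀ i, SimpleGraph (W i)} {i j : ι} (hi : (F i).IsBGraph)
    (hj : (F j).IsCStarGraph) :
    ∃ (m M D : ℕ) (l : (F j).ConnectedComponent → ℕ), (∀ K, 1 ≤ l K) ∧
      ListRamsey F 2 (functionalGraph
        fun v : Σ q : (F j).ConnectedComponent × {x : Fin m × Fin m // x.1 ≠ x.2} × Fin M,
          ZMod (2 * l q.1 + 1) × Option (Fin D) => ⟨v.1, hairyCycleMap (l v.1.1) D v.2⟩) := by
  classical
  have := Fintype.ofFinite (F j).ConnectedComponent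
  obtain ⟨b₀, hb₀⟩ := hi.exists_broom
  have hK (K : (F j).ConnectedComponent) : ∃ l, 1 ≤ l ∧
      (K.toSimpleGraph.IsContained (cycleGraph (2 * l + 1)) ∨ K.toSimpleGraph.IsStar) := by
    rcases hj K with ⟨l, hl, h⟩ | h
    · exact ⟨l, hl, .inl h⟩
    · exact ⟨1, le_rfl, .inr h⟩
  choose l hl hK using hK
  set t := Nat.card (F i).ConnectedComponent
  -- at least one hair is needed, since the path of a broom may start with a hair
  set β := b₀ + Nat.card (W j) + 1 with hβ
  refine ⟨Fintype.card (F j).ConnectedComponent + 1, 2 * t, 2 * β, l, hl,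
    listRamsey_functionalGraph_sigma
      (Q := (F j).ConnectedComponent × {x : Fin (Fintype.card (F j).ConnectedComponent + 1) ×
        Fin (Fintype.card (F j).ConnectedComponent + 1) // x.1 ≠ x.2} × Fin (2 * t))
      (fun q => hairyCycleMap (l q.1) (2 * β))
      (fun q => hairyCycleMap_ne (hl q.1)) (fun q => {q.2.1.1.1.val, q.2.1.1.2.val})
      (fun q => Finset.card_pair fun h => q.2.1.2 (Fin.ext h)) fun H κ hκ hH => ?_⟩
  have hgadget (q : (F j).ConnectedComponent ×
      {x : Fin (Fintype.card (F j).ConnectedComponent + 1) ×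
        Fin (Fintype.card (F j).ConnectedComponent + 1) // x.1 ≠ x.2} × Fin (2 * t)) :
      ∃ c ∈ ({q.2.1.1.1.val, q.2.1.1.2.val} : Finset ℕ),
        (broom β).IsContained ((H c).sigmaPart q) ∨
        q.1.toSimpleGraph.IsContained ((H c).sigmaPart q) := by
    have hab : q.2.1.1.1.val ≠ q.2.1.1.2.val := fun h => q.2.1.2 (Fin.ext h)
    rcases hK q.1 with h | h
    · obtain ⟨c, hc, hc'⟩ := exists_broom_or_cycle (hl q.1) (by omega : 1 ≤ β) le_rfl hab
        (fun c => (H c).sigmaPart q) (fun x => κ ⟨q, x⟩) (fun x => hκ ⟨q, x⟩)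
        (fun x => hH ⟨q, x⟩)
      exact ⟨c, hc, hc'.imp id h.trans⟩
    · obtain ⟨c, hc, hc'⟩ := exists_star_of_hairs (β := β)
        (fun c => (H c).sigmaPart q) (fun x => κ ⟨q, x⟩)
        {q.2.1.1.1.val, q.2.1.1.2.val} ⟨_, Finset.mem_insert_self _ _⟩
        (fun x => hκ ⟨q, x⟩) (by rw [Finset.card_pair hab]) (fun x => hH ⟨q, x⟩)
      refine ⟨c, hc, .inr (hc' _ _ h ?_)⟩
      have : Nat.card q.1.supp ≤ Nat.card (W j) :=
        Nat.card_le_card_of_injective _ Subtype.val_injective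
      exact this.trans (by omega)
  by_cases hall : ∃ c : Fin (Fintype.card (F j).ConnectedComponent + 1),
      ∀ K : (F j).ConnectedComponent, ∃ x y,
        K.toSimpleGraph.IsContained ((H c).sigmaPart (K, x, y))
  · obtain ⟨c, hc⟩ := hall
    choose x y hxy using hc
    exact ⟨j, c, isContained_of_forall_component (fun K => (K, x K, y K))
      (fun K K' h => congrArg Prod.fst h) hxy⟩
  · refine ⟨i, ?_⟩
    push Not at hall
    choose K hK' using hall
    obtain ⟨a, b, hab, hKab⟩ := Fintype.exists_ne_map_eq_of_card_lt K (by simp)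
    choose d hd hd' using fun y : Fin (2 * t) => hgadget (K a, ⟨(a, b), hab⟩, y)
    have hbroom (y : Fin (2 * t)) : (broom β).IsContained
        ((H (d y)).sigmaPart (K a, ⟨(a, b), hab⟩, y)) := by
      refine (hd' y).resolve_right fun h => ?_
      have hdy := hd y
      simp only [Finset.mem_insert, Finset.mem_singleton] at hdy
      rcases hdy with hdy | hdy
      · rw [hdy] at h
        exact not_nonempty_iff.2 (hK' a _ _) h
      · rw [hdy] at h
        have := hK' b ⟨(a, b), hab⟩ y
        rw [← hKab] at this
        exact not_nonempty_iff.2 this h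
    obtain ⟨c, -, hc⟩ := Finset.exists_le_card_fiber_of_mul_le_card_of_maps_to
      (s := Finset.univ) (t := {a.val, b.val}) (f := d) (n := t) (fun y _ => hd y)
      ⟨_, Finset.mem_insert_self _ _⟩
      (by rw [Finset.card_pair fun h => hab (Fin.ext h)]; simp)
    refine ⟨c, isContained_of_card_le
      ((Finset.univ.filter fun y => d y = c).map
        ⟨fun y => (K a, ⟨(a, b), hab⟩, y), fun y y' h => by simpa using h⟩)
      (by rwa [Finset.card_map]) fun q hq C => ?_⟩
    obtain ⟨y, hy, rfl⟩ := Finset.mem_map.1 hq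
    have := hbroom y
    rw [(Finset.mem_filter.1 hy).2] at this
    exact (hb₀ β (by omega) C).trans this

end SimpleGraph

theorem mainTheorem3 {ι : Type*} {W : ι → Type*} [∀ i, Finite (W i)]
    (F : ∀ i, SimpleGraph (W i)) (r : ℕ) (hr : 2 ≤ r) :
    (¬ SimpleGraph.ListRamseyExceptional F r →
      ∃ c₀ : ℝ, 0 < c₀ ∧ ∀ p : ℕ → unitInterval,
        (∀ᶠ n : ℕ in atTop, (p n : ℝ) ≤ c₀ / (n : ℝ)) →
          Tendsto (fun n : ℕ => SimpleGraph.probListRamsey F r n (p n)) atTop (𝓝 0)) ∧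
    (SimpleGraph.ListRamseyExceptional F r →
      ∀ p : ℕ → unitInterval,
        (∃ c : ℝ, 0 < c ∧ ∀ᶠ n : ℕ in atTop, c / (n : ℝ) ≤ (p n : ℝ)) →
          ∃ δ : ℝ, 0 < δ ∧
            ∀ᶠ n : ℕ in atTop, δ ≤ SimpleGraph.probListRamsey F r n (p n)) := by
  refine ⟨fun hex => ⟨1 / 40, by norm_num,
    SimpleGraph.tendsto_probListRamsey_of_not_exceptional hr hex⟩, ?_⟩
  rintro (⟨i, hi⟩ | ⟨rfl, ⟨i, hi⟩, j, hj⟩) p ⟨c, hc, hp⟩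
  · obtain ⟨N, D, h⟩ := SimpleGraph.exists_listRamsey_of_isStarForest hr hi
    exact SimpleGraph.exists_pos_le_probListRamsey (fun _ => 1) (fun _ => le_rfl) D h p c hc hp
  · obtain ⟨m, M, D, l, hl, h⟩ :=
      SimpleGraph.exists_listRamsey_of_isBGraph_of_isCStarGraph hi hj
    exact SimpleGraph.exists_pos_le_probListRamsey
      (Q := (F j).ConnectedComponent × {x : Fin m × Fin m // x.1 ≠ x.2} × Fin M)
      (fun q => l q.1) (fun q => hl q.1) D h p c hc hp
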